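/- Let $m_2<m_1$ be nonnegative integers and $n=m_1+m_2+1$. For a function $f$ that is $m_1$ times differentiable at each point of $(0,\infty)$ and for $0<a<b$, let $P$ and $Q$ be the polynomials of degree at most $n$ with $P^{(j)}(a)=f^{(j)}(a)$ and $Q^{(j)}(b)=f^{(j)}(b)$ for $0\le j\le m_1$, and $P^{(j)}(b)=f^{(j)}(b)$ and $Q^{(j)}(a)=f^{(j)}(a)$ for $0\le j\le m_2$. Let $M_{f,m_1,m_2}(a,b)$ denote the unique $x\in(a,b)$ with $P(x)=Q(x)$ if $m_1-m_2$ is even, and with $f(x)=\frac12(P(x)+Q(x))$ if $m_1-m_2$ is odd (whenever there is exactly one such $x$), and put $M_{f,m_1,m_2}(b,a)=M_{f,m_1,m_2}(a,b)$ and $M_{f,m_1,m_2}(a,a)=a$. A mean is a continuous function $m$ on $\{(a,b):a,b>0\}$ with $\min(a,b)\le m(a,b)\le\max(a,b)$; it is homogeneous if $m(ka,kb)=k\,m(a,b)$ for all $k,a,b>0$. For real $q$ let $M_{q,m_1,m_2}=M_{g,m_1,m_2}$, where $g(x)=x^q$ if $q\notin\{0,1,\dots,n\}$ and $g(x)=x^q\log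 x$ if $q\in\{0,1,\dots,n\}$. If $f\in C^{n+2}(0,\infty)$ and $M_{f,m_1,m_2}$ is (everywhere defined and) a homogeneous mean, then there are real numbers $c$ and $p$ with $f^{(n+1)}(x)=cx^p$ for all $x>0$, and $M_{f,m_1,m_2}=M_{p+n+1,m_1,m_2}$. Conversely, $M_{q,m_1,m_2}$ is a homogeneous mean for every real $q$. So the power means $M_{q,m_1,m_2}$ are exactly the homogeneous means in this family. -/

import Mathlib

open Set

noncomputable section

/-- `P` is the Hermite interpolant of degree at most `r + s + 1` that matches `f` to order `r`
at `a` and to order `s` at `b`. -/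
def IsHermiteInterpolant (f : ℝ → ℝ) (r s : ℕ) (a b : ℝ) (P : Polynomial ℝ) : Prop :=
  P.natDegree ≤ r + s + 1 ∧
  (∀ j ≤ r, (Polynomial.derivative^[j] P).eval a = iteratedDeriv j f a) ∧
  (∀ j ≤ s, (Polynomial.derivative^[j] P).eval b = iteratedDeriv j f b)

/-- `x` satisfies the equation that defines the mean: with `P` the interpolant of orders
`m₁` at `a`, `m₂` at `b`, and `Q` the interpolant of orders `m₂` at `a`, `m₁` at `b`,
`P x = Q x` if `m₁ - m₂` is even, and `f x = (P x + Q x) / 2` if `m₁ - m₂` is odd. -/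
def IsHermiteCrossing (f : ℝ → ℝ) (m₁ m₂ : ℕ) (a b x : ℝ) : Prop :=
  ∃ P Q : Polynomial ℝ,
    IsHermiteInterpolant f m₁ m₂ a b P ∧ IsHermiteInterpolant f m₂ m₁ a b Q ∧
    (Even (m₁ - m₂) → P.eval x = Q.eval x) ∧
    (Odd (m₁ - m₂) → f x = (P.eval x + Q.eval x) / 2)

open scoped Classical in
/-- `M_{f,m₁,m₂}(a,b)`: the unique solution of the defining equation strictly between `a` and
`b`, extended symmetrically and by `M(a,a) = a`. If `a ≠ b` and there is no solution, or more
than one, the value is `0`; for `a, b > 0` this lies outside `[min a b, max a b]`, so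
such a function is not a mean. -/
def hermiteMean (f : ℝ → ℝ) (m₁ m₂ : ℕ) (a b : ℝ) : ℝ :=
  if a = b then a
  else if h : ∃! x, x ∈ Ioo (min a b) (max a b) ∧
      IsHermiteCrossing f m₁ m₂ (min a b) (max a b) x then h.choose
  else 0

/-- A mean in two positive variables. -/
def IsMean (m : ℝ → ℝ → ℝ) : Prop :=
  ContinuousOn (fun z : ℝ × ℝ => m z.1 z.2) {z | 0 < z.1 ∧ 0 < z.2} ∧
  ∀ a b : ℝ, 0 < a → 0 < b → min a b ≤ m a b ∧ m a b ≤ max a b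

/-- A mean that is homogeneous of degree one. -/
def IsHomogeneousMean (m : ℝ → ℝ → ℝ) : Prop :=
  IsMean m ∧ ∀ k a b : ℝ, 0 < k → 0 < a → 0 < b → m (k * a) (k * b) = k * m a b

open scoped Classical in
/-- The function defining the power mean of exponent `p`: `x ^ p` if `p ∉ {0, …, n}`, and
`x ^ p * log x` if `p ∈ {0, …, n}`, where `n = m₁ + m₂ + 1`. -/
def powerFun (m₁ m₂ : ℕ) (p : ℝ) (x : ℝ) : ℝ :=
  if ∃ k : ℕ, k ≤ m₁ + m₂ + 1 ∧ p = k then x ^ p * Real.log x else x ^ p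

/-- The power mean `M_{p,m₁,m₂}`. -/
def powerHermiteMean (p : ℝ) (m₁ m₂ : ℕ) : ℝ → ℝ → ℝ :=
  hermiteMean (powerFun m₁ m₂ p) m₁ m₂

end

/-! Let `N = n + 1`, `k = m₁ - m₂` and `φ = f⁽ᴺ⁾`. The interpolation errors `f - P` and `f - Q` are
node polynomials times divided differences, and the latter are iterated averages of `φ`
(`IsDerivChain.eq_prod_mul_remIter`). Cancelling the common factor turns the crossing equation, for
both parities of `k`, into `(x - a)ᵏ H(a,b;x) = (b - x)ᵏ H(b,a;x)`, where `H = hermRem` depends only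
on `φ` (`isHermiteCrossing_iff`).

If `φ` is a nonzero constant times a positive function, the difference of the two sides is strictly
increasing and changes sign, so the mean exists; moving the endpoints slightly shows that it is
continuous. For `φ = C x ^ p` scaling gives homogeneity. The function defining `M_q` has such a
derivative, with `p = q - N`.

Conversely, homogeneity makes the relative position `u` of `M(a, a + a t)` in its interval
independent of `a`. Replacing `φ` by its tangent at `a` yields `uᵏ - (1 - u)ᵏ = t · (a φ'(a) / φ(a))
/ (N + 1) · crossCoeff u + o(t)`, and `crossCoeff u` stays away from `0` for small `t`. Hence `a
φ'(a) / φ(a)` is the same wherever `φ ≠ 0` (`logDeriv_iteratedDeriv_const`), and Euler's equation `x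
φ' = p φ` forces `φ = c x ^ p`. -/

open MeasureTheory Filter Topology

/-! ### Weighted averages along segments. -/

/-- The weighted average of `φ` over the segment from `c` to `x`. -/
noncomputable def remAvg (j : ℕ) (c : ℝ) (φ : ℝ → ℝ) (x : ℝ) : ℝ :=
  ∫ s in (0 : ℝ)..1, s ^ j * φ (c + s * (x - c))

/-- Iterated weighted averages; `remIter 0 L f^{(N)} x` with `N = L.length` is the divided
difference of `f` at `x` and the nodes `L`, and `remIter i` is its `i`-th derivative for
`f^{(N + i)}`. -/
noncomputable def remIter (i : ℕ) : List ℝ → (ℝ → ℝ) → ℝ → ℝ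
  | [], φ => φ
  | c :: L, φ => remIter i L (remAvg (i + L.length) c φ)

theorem segment_pos {c x s : ℝ} (hc : 0 < c) (hx : 0 < x) (hs : s ∈ Icc (0 : ℝ) 1) :
    0 < c + s * (x - c) := by
  rcases eq_or_lt_of_le hs.1 with h | h
  · simpa [← h] using hc
  · nlinarith [mul_pos h hx, mul_nonneg (sub_nonneg.2 hs.2) hc.le]

theorem continuousOn_segment_comp {φ : ℝ → ℝ} (hφ : ContinuousOn φ (Ioi 0)) {c x : ℝ}
    (hc : 0 < c) (hx : 0 < x) (j : ℕ) :
    ContinuousOn (fun s : ℝ => s ^ j * φ (c + s * (x - c))) (Icc 0 1) := by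
  refine (by fun_prop : Continuous fun s : ℝ => s ^ j).continuousOn.mul ?_
  exact hφ.comp (by fun_prop) fun s hs => segment_pos hc hx hs

theorem intervalIntegrable_segment_comp {φ : ℝ → ℝ} (hφ : ContinuousOn φ (Ioi 0)) {c x : ℝ}
    (hc : 0 < c) (hx : 0 < x) (j : ℕ) :
    IntervalIntegrable (fun s : ℝ => s ^ j * φ (c + s * (x - c))) volume 0 1 := by
  apply ContinuousOn.intervalIntegrable
  rw [uIcc_of_le zero_le_one]
  exact continuousOn_segment_comp hφ hc hx j

/-- Precomposing with `projIcc` extends the integrand continuously to all `s`, without changing it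
on `[0, 1]`. -/
theorem continuousOn_parametric_integral {Y : Type*} [TopologicalSpace Y]
    [FirstCountableTopology Y] {F : Y → ℝ → ℝ} {S : Set Y}
    (hF : ContinuousOn (Function.uncurry F) (S ×ˢ Icc 0 1)) :
    ContinuousOn (fun y => ∫ s in (0 : ℝ)..1, F y s) S := by
  rw [continuousOn_iff_continuous_domRestrict]
  have key : Continuous fun y : S => ∫ s in (0 : ℝ)..1, F y (projIcc (0 : ℝ) 1 zero_le_one s) := by
    apply intervalIntegral.continuous_parametric_intervalIntegral_of_continuous'
    refine hF.comp_continuous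
      (f := fun p : S × ℝ => ((p.1 : Y), (projIcc (0 : ℝ) 1 zero_le_one p.2 : ℝ))) ?_ ?_
    · exact (continuous_subtype_val.comp continuous_fst).prodMk
        (continuous_subtype_val.comp (continuous_projIcc.comp continuous_snd))
    · intro p
      exact ⟨p.1.2, (projIcc (0 : ℝ) 1 zero_le_one p.2).2⟩
  refine key.congr fun y => ?_
  apply intervalIntegral.integral_congr
  intro s hs
  rw [uIcc_of_le zero_le_one] at hs
  simp only [projIcc_of_mem zero_le_one hs]

theorem continuousOn_remAvg_param {Z : Type*} [TopologicalSpace Z] [FirstCountableTopology Z]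
    {U : Set Z} {Φ : Z → ℝ → ℝ} {c : Z → ℝ} (j : ℕ)
    (hΦ : ContinuousOn (fun p : Z × ℝ => Φ p.1 p.2) (U ×ˢ Ioi 0))
    (hc : ContinuousOn c U) (hc0 : ∀ z ∈ U, 0 < c z) :
    ContinuousOn (fun p : Z × ℝ => remAvg j (c p.1) (Φ p.1) p.2) (U ×ˢ Ioi 0) := by
  unfold remAvg
  apply continuousOn_parametric_integral
    (F := fun (p : Z × ℝ) s => s ^ j * Φ p.1 (c p.1 + s * (p.2 - c p.1)))
  have h1 : ContinuousOn (fun q : (Z × ℝ) × ℝ => c q.1.1) ((U ×ˢ Ioi 0) ×ˢ Icc 0 1) :=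
    hc.comp (by fun_prop) fun q hq => hq.1.1
  refine ContinuousOn.mul (by fun_prop) ?_
  refine hΦ.comp (f := fun q : (Z × ℝ) × ℝ => (q.1.1, c q.1.1 + q.2 * (q.1.2 - c q.1.1))) ?_ ?_
  · exact ContinuousOn.prodMk (by fun_prop)
      (h1.add (ContinuousOn.mul (by fun_prop) (ContinuousOn.sub (by fun_prop) h1)))
  · intro q hq
    exact ⟨hq.1.1, segment_pos (hc0 _ hq.1.1) hq.1.2 hq.2⟩

/-- The nodes are functions of a parameter so that joint continuity in the endpoints and the point
becomes available; continuity of the mean rests on it. -/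
theorem continuousOn_remIter_param {Z : Type*} [TopologicalSpace Z] [FirstCountableTopology Z]
    {U : Set Z} (i : ℕ) (L : List (Z → ℝ)) (hL : ∀ c ∈ L, ContinuousOn c U ∧ ∀ z ∈ U, 0 < c z)
    {Φ : Z → ℝ → ℝ} (hΦ : ContinuousOn (fun p : Z × ℝ => Φ p.1 p.2) (U ×ˢ Ioi 0)) :
    ContinuousOn (fun p : Z × ℝ => remIter i (L.map fun c => c p.1) (Φ p.1) p.2)
      (U ×ˢ Ioi 0) := by
  induction L generalizing Φ with
  | nil => simpa [remIter] using hΦ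
  | cons c L ih =>
    have hc := hL c (by simp)
    have := ih (Φ := fun z => remAvg (i + L.length) (c z) (Φ z)) (fun d hd => hL d (by simp [hd]))
      (continuousOn_remAvg_param (i + L.length) hΦ hc.1 hc.2)
    simpa [remIter] using this

theorem continuousOn_remAvg {φ : ℝ → ℝ} (hφ : ContinuousOn φ (Ioi 0)) {c : ℝ} (hc : 0 < c)
    (j : ℕ) : ContinuousOn (remAvg j c φ) (Ioi 0) := by
  have := continuousOn_remAvg_param (Z := Unit) (U := univ) (Φ := fun _ => φ) (c := fun _ => c) j
    (hφ.comp continuousOn_snd fun p hp => hp.2) continuousOn_const (fun _ _ => hc)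
  exact this.comp (f := fun x : ℝ => ((), x)) (by fun_prop) fun x hx => ⟨mem_univ _, hx⟩

theorem hasDerivAt_remAvg {g g' : ℝ → ℝ} (hg : ∀ x, 0 < x → HasDerivAt g (g' x) x)
    (hg' : ContinuousOn g' (Ioi 0)) {c x : ℝ} (hc : 0 < c) (hx : 0 < x) (j : ℕ) :
    HasDerivAt (remAvg j c g) (remAvg (j + 1) c g' x) x := by
  have hgc : ContinuousOn g (Ioi 0) := fun y hy => (hg y hy).continuousAt.continuousWithinAt
  -- This compact interval contains every segment from `c` to a point `y` of `(x/2, 2x)`, so `B`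
  -- dominates the differentiated integrand.
  obtain ⟨B, hB⟩ := (isCompact_Icc (a := min c (x / 2)) (b := max c (2 * x))).exists_bound_of_continuousOn
    (hg'.mono fun y hy => lt_of_lt_of_le (lt_min hc (by positivity)) hy.1)
  have hs : Ioo (x / 2) (2 * x) ∈ 𝓝 x := Ioo_mem_nhds (by linarith) (by linarith)
  have hmem : ∀ t ∈ uIoc (0 : ℝ) 1, t ∈ Icc (0 : ℝ) 1 := fun t ht => by
    rw [uIoc_of_le zero_le_one] at ht; exact ⟨ht.1.le, ht.2⟩
  have hmeas : ∀ {φ : ℝ → ℝ}, ContinuousOn φ (Ioi 0) → ∀ y, 0 < y → ∀ k : ℕ,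
      AEStronglyMeasurable (fun s : ℝ => s ^ k * φ (c + s * (y - c)))
        (volume.restrict (uIoc (0 : ℝ) 1)) := fun hφ y hy k =>
    ((continuousOn_segment_comp hφ hc hy k).mono hmem).aestronglyMeasurable measurableSet_uIoc
  refine (intervalIntegral.hasDerivAt_integral_of_dominated_loc_of_deriv_le
    (F := fun y s => s ^ j * g (c + s * (y - c)))
    (F' := fun y s => s ^ (j + 1) * g' (c + s * (y - c)))
    (bound := fun _ => B) hs ?_ ?_ ?_ ?_ ?_ ?_).2
  · filter_upwards [hs] with y hy
    exact hmeas hgc y (by linarith [hy.1]) j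
  · exact intervalIntegrable_segment_comp hgc hc hx j
  · exact hmeas hg' x hx (j + 1)
  · refine Eventually.of_forall fun t ht y hy => ?_
    have ht := hmem t ht
    rw [norm_mul, norm_pow, Real.norm_of_nonneg ht.1]
    have h1 : ‖g' (c + t * (y - c))‖ ≤ B := by
      apply hB
      have e : c + t * (y - c) = (1 - t) * c + t * y := by ring
      constructor
      · nlinarith [min_le_left c (x / 2), min_le_right c (x / 2), hy.1, ht.1, ht.2]
      · nlinarith [le_max_left c (2 * x), le_max_right c (2 * x), hy.2, ht.1, ht.2]
    calc t ^ (j + 1) * ‖g' (c + t * (y - c))‖ ≤ 1 * ‖g' (c + t * (y - c))‖ := by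
          gcongr; exact pow_le_one₀ ht.1 ht.2
      _ ≤ B := by rw [one_mul]; exact h1
  · exact intervalIntegrable_const
  · refine Eventually.of_forall fun t ht y hy => ?_
    have hy0 : 0 < y := by linarith [hy.1]
    have h1 : HasDerivAt (fun y : ℝ => c + t * (y - c)) t y := by
      simpa using (((hasDerivAt_id y).sub_const c).const_mul t).const_add c
    have h2 := ((hg _ (segment_pos hc hy0 (hmem t ht))).comp y h1).const_mul (t ^ j)
    exact h2.congr_deriv (by rw [pow_succ]; ring)

theorem mul_remAvg_zero {ψ : ℝ → ℝ} (c x : ℝ) :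
    (x - c) * remAvg 0 c ψ x = ∫ t in c..x, ψ t := by
  unfold remAvg
  have := intervalIntegral.mul_integral_comp_add_mul (a := 0) (b := 1) (f := ψ) (x - c) c
  simp only [pow_zero, one_mul]
  rw [show (fun s : ℝ => ψ (c + s * (x - c))) = fun s => ψ (c + (x - c) * s) by
    ext s; rw [mul_comm]]
  rw [this]
  simp

theorem remAvg_self (j : ℕ) (c : ℝ) (φ : ℝ → ℝ) : remAvg j c φ c = φ c / (j + 1) := by
  simp [remAvg, integral_pow, div_eq_inv_mul]

theorem remAvg_mono {φ ψ : ℝ → ℝ} (hφ : ContinuousOn φ (Ioi 0)) (hψ : ContinuousOn ψ (Ioi 0))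
    {a b : ℝ} (ha : 0 < a) (h : ∀ y ∈ Icc a b, φ y ≤ ψ y) {c x : ℝ} (hc : c ∈ Icc a b)
    (hx : x ∈ Icc a b) (j : ℕ) : remAvg j c φ x ≤ remAvg j c ψ x := by
  have hc0 : 0 < c := ha.trans_le hc.1
  have hx0 : 0 < x := ha.trans_le hx.1
  refine intervalIntegral.integral_mono_on zero_le_one (intervalIntegrable_segment_comp hφ hc0 hx0 j)
    (intervalIntegrable_segment_comp hψ hc0 hx0 j) fun s hs => ?_
  refine mul_le_mul_of_nonneg_left (h _ ?_) (pow_nonneg hs.1 j)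
  have := (convex_Icc a b) hc hx (sub_nonneg.2 hs.2) hs.1 (by ring)
  simp only [smul_eq_mul] at this
  convert this using 1
  ring

theorem remAvg_pos {φ : ℝ → ℝ} (hφ : ContinuousOn φ (Ioi 0)) (h : ∀ y, 0 < y → 0 < φ y)
    {c x : ℝ} (hc : 0 < c) (hx : 0 < x) (j : ℕ) : 0 < remAvg j c φ x :=
  intervalIntegral.intervalIntegral_pos_of_pos_on (intervalIntegrable_segment_comp hφ hc hx j)
    (fun _ hs => mul_pos (pow_pos hs.1 j) (h _ (segment_pos hc hx ⟨hs.1.le, hs.2.le⟩))) one_pos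

theorem remAvg_congr {φ ψ : ℝ → ℝ} (h : EqOn φ ψ (Ioi 0)) {c : ℝ} (hc : 0 < c) (j : ℕ) :
    EqOn (remAvg j c φ) (remAvg j c ψ) (Ioi 0) := by
  intro x hx
  apply intervalIntegral.integral_congr
  intro s hs
  rw [uIcc_of_le zero_le_one] at hs
  simp only [h (segment_pos hc hx hs)]

theorem remAvg_const_mul (j : ℕ) (c : ℝ) (φ : ℝ → ℝ) (C : ℝ) :
    remAvg j c (fun y => C * φ y) = fun x => C * remAvg j c φ x := by
  ext x
  unfold remAvg
  rw [← intervalIntegral.integral_const_mul]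
  congr 1; ext s; ring

theorem remAvg_scale (j : ℕ) (c : ℝ) (φ : ℝ → ℝ) (k : ℝ) :
    (fun x => remAvg j (k * c) φ (k * x)) = remAvg j c (fun y => φ (k * y)) := by
  ext x
  unfold remAvg
  congr 1; ext s
  congr 2; ring

theorem remAvg_affine (j : ℕ) (c α β : ℝ) :
    remAvg j c (fun y => α * y + β) =
      fun x => α / (j + 2) * x + (α * c / ((j + 1) * (j + 2)) + β / (j + 1)) := by
  ext x
  unfold remAvg
  have : (fun s : ℝ => s ^ j * (α * (c + s * (x - c)) + β)) =
      fun s => s ^ j * (α * c + β) + s ^ (j + 1) * (α * (x - c)) := by ext s; ring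
  have hj : (j : ℝ) + 1 ≠ 0 := by positivity
  have hj' : (j : ℝ) + 2 ≠ 0 := by positivity
  rw [this, intervalIntegral.integral_add (by apply Continuous.intervalIntegrable; fun_prop)
    (by apply Continuous.intervalIntegrable; fun_prop), intervalIntegral.integral_mul_const,
    intervalIntegral.integral_mul_const, integral_pow, integral_pow]
  push_cast
  simp only [one_pow, ne_eq, Nat.add_eq_zero_iff, one_ne_zero, and_false, not_false_eq_true,
    zero_pow, sub_zero, show (j : ℝ) + 1 + 1 = j + 2 by ring]
  field_simp
  ring

/-! ### Iterated averages. -/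

section Iter

variable (i : ℕ) {L : List ℝ}

/-- Exposes the last node as the outermost average; with `i = 0`, `mul_remAvg_zero` then gives `(x -
c)` times the divided difference as an integral. -/
theorem remIter_append (L : List ℝ) (c : ℝ) (φ : ℝ → ℝ) :
    remIter i (L ++ [c]) φ = remAvg i c (remIter (i + 1) L φ) := by
  induction L generalizing φ with
  | nil => simp [remIter]
  | cons d L ih => simp [remIter, ih, add_assoc, add_comm 1]

theorem continuousOn_remIter (hL : ∀ c ∈ L, 0 < c) {φ : ℝ → ℝ} (hφ : ContinuousOn φ (Ioi 0)) :
    ContinuousOn (remIter i L φ) (Ioi 0) := by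
  induction L generalizing φ with
  | nil => exact hφ
  | cons c L ih =>
    exact ih (fun d hd => hL d (by simp [hd])) (continuousOn_remAvg hφ (hL c (by simp)) _)

theorem remIter_mono {a b : ℝ} (ha : 0 < a) (hL : ∀ c ∈ L, c ∈ Icc a b) {φ ψ : ℝ → ℝ}
    (hφ : ContinuousOn φ (Ioi 0)) (hψ : ContinuousOn ψ (Ioi 0))
    (h : ∀ y ∈ Icc a b, φ y ≤ ψ y) {x : ℝ} (hx : x ∈ Icc a b) :
    remIter i L φ x ≤ remIter i L ψ x := by
  induction L generalizing φ ψ with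
  | nil => exact h x hx
  | cons c L ih =>
    have hc := hL c (by simp)
    have hc0 : 0 < c := ha.trans_le hc.1
    exact ih (fun d hd => hL d (by simp [hd])) (continuousOn_remAvg hφ hc0 _)
      (continuousOn_remAvg hψ hc0 _) fun y hy => remAvg_mono hφ hψ ha h hc hy _

theorem remIter_pos (hL : ∀ c ∈ L, 0 < c) {φ : ℝ → ℝ} (hφ : ContinuousOn φ (Ioi 0))
    (h : ∀ y, 0 < y → 0 < φ y) {x : ℝ} (hx : 0 < x) : 0 < remIter i L φ x := by
  induction L generalizing φ with
  | nil => exact h x hx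
  | cons c L ih =>
    have hc := hL c (by simp)
    exact ih (fun d hd => hL d (by simp [hd])) (continuousOn_remAvg hφ hc _)
      fun y hy => remAvg_pos hφ h hc hy _

theorem remIter_congr (hL : ∀ c ∈ L, 0 < c) {φ ψ : ℝ → ℝ} (h : EqOn φ ψ (Ioi 0)) :
    EqOn (remIter i L φ) (remIter i L ψ) (Ioi 0) := by
  induction L generalizing φ ψ with
  | nil => exact h
  | cons c L ih =>
    exact ih (fun d hd => hL d (by simp [hd])) (remAvg_congr h (hL c (by simp)) _)

theorem remIter_const_mul (L : List ℝ) (φ : ℝ → ℝ) (C : ℝ) :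
    remIter i L (fun y => C * φ y) = fun x => C * remIter i L φ x := by
  induction L generalizing φ with
  | nil => rfl
  | cons c L ih => simp only [remIter, remAvg_const_mul, ih]

theorem remIter_scale (L : List ℝ) (φ : ℝ → ℝ) (k : ℝ) :
    (fun x => remIter i (L.map (k * ·)) φ (k * x)) = remIter i L (fun y => φ (k * y)) := by
  induction L generalizing φ with
  | nil => rfl
  | cons c L ih =>
    simp only [remIter, List.map_cons, List.length_map, ih, remAvg_scale]

/-- The divided difference of `x ^ (N + 1)` at `N + 1` points is the sum of the points. This is what
makes the short-interval expansion explicit. -/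
theorem remIter_affine (L : List ℝ) (α β : ℝ) :
    remIter 0 L (fun y => α * y + β) = fun x =>
      α * (x + L.sum) / ((L.length + 1).factorial : ℝ) + β / (L.length.factorial : ℝ) := by
  induction L generalizing α β with
  | nil => simp [remIter]
  | cons c L ih =>
    simp only [remIter, remAvg_affine, ih, zero_add, List.length_cons, List.sum_cons]
    ext x
    have h0 : ((L.length).factorial : ℝ) ≠ 0 := by positivity
    have h1 : (L.length : ℝ) + 1 ≠ 0 := by positivity
    have h2 : (L.length : ℝ) + 2 ≠ 0 := by positivity
    rw [Nat.factorial_succ (L.length + 1), Nat.factorial_succ L.length]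
    push_cast
    rw [show (L.length : ℝ) + 1 + 1 = L.length + 2 by ring]
    field_simp
    ring

end Iter

/-! ### Divided differences of functions with prescribed zeros. -/

/-- On the positive half-line, `F 0, …, F N` are the successive derivatives of `F 0`, the last of
them continuous. -/
structure IsDerivChain (N : ℕ) (F : ℕ → ℝ → ℝ) : Prop where
  hasDerivAt : ∀ i < N, ∀ x, 0 < x → HasDerivAt (F i) (F (i + 1) x) x
  continuousOn_last : ContinuousOn (F N) (Ioi 0)

/-- The successive derivatives of the difference quotient `(F 0 x - F 0 c) / (x - c)`. -/
noncomputable def remChain (c : ℝ) (F : ℕ → ℝ → ℝ) (j : ℕ) : ℝ → ℝ := remAvg j c (F (j + 1))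

namespace IsDerivChain

variable {N : ℕ} {F G : ℕ → ℝ → ℝ} {c : ℝ}

theorem continuousOn (h : IsDerivChain N F) {i : ℕ} (hi : i ≤ N) :
    ContinuousOn (F i) (Ioi 0) := by
  rcases hi.eq_or_lt with rfl | hi
  · exact h.continuousOn_last
  · exact fun x hx => (h.hasDerivAt i hi x hx).continuousAt.continuousWithinAt

theorem sub (h : IsDerivChain N F) (h' : IsDerivChain N G) :
    IsDerivChain N fun i x => F i x - G i x :=
  ⟨fun i hi x hx => (h.hasDerivAt i hi x hx).sub (h'.hasDerivAt i hi x hx),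
    h.continuousOn_last.sub h'.continuousOn_last⟩

theorem remChain (h : IsDerivChain (N + 1) F) (hc : 0 < c) : IsDerivChain N (remChain c F) :=
  ⟨fun i hi _ hx => hasDerivAt_remAvg (fun y hy => h.hasDerivAt (i + 1) (by omega) y hy)
      (h.continuousOn (by omega)) hc hx i,
    continuousOn_remAvg h.continuousOn_last hc N⟩

theorem sub_mul_remChain_zero (h : IsDerivChain (N + 1) F) (hc : 0 < c) {x : ℝ} (hx : 0 < x) :
    (x - c) * _root_.remChain c F 0 x = F 0 x - F 0 c := by
  have hpos : ∀ y ∈ uIcc c x, 0 < y := fun y hy => (lt_min hc hx).trans_le hy.1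
  unfold _root_.remChain
  rw [mul_remAvg_zero]
  refine intervalIntegral.integral_eq_sub_of_hasDerivAt
    (fun y hy => h.hasDerivAt 0 (by omega) y (hpos y hy)) ?_
  exact ((h.continuousOn (by omega)).mono fun y hy => hpos y hy).intervalIntegrable

/-- Leibniz's rule: differentiate `(x - c) g = F 0 - F 0 c` `j + 1` times, where `g` is the
difference quotient. -/
theorem sub_mul_remChain_succ (h : IsDerivChain (N + 1) F) (hc : 0 < c) {j : ℕ} (hj : j < N)
    {x : ℝ} (hx : 0 < x) :
    (x - c) * _root_.remChain c F (j + 1) x + (j + 1) * _root_.remChain c F j x = F (j + 1) x := by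
  have hT := h.remChain hc
  have hlin : HasDerivAt (fun y : ℝ => y - c) 1 x := (hasDerivAt_id x).sub_const c
  induction j generalizing x with
  | zero =>
    have h1 := hlin.mul (hT.hasDerivAt 0 hj x hx)
    have h2 := (h.hasDerivAt 0 (by omega) x hx).sub_const (F 0 c)
    have h3 := h1.unique (h2.congr_of_eventuallyEq ?_)
    · simp only [zero_add] at h3 ⊢
      push_cast
      linarith
    · filter_upwards [Ioi_mem_nhds hx] with y hy
      exact h.sub_mul_remChain_zero hc hy
  | succ j ih =>
    have h1 := (hlin.mul (hT.hasDerivAt (j + 1) hj x hx)).add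
      ((hT.hasDerivAt j (by omega) x hx).const_mul ((j : ℝ) + 1))
    have h2 := h.hasDerivAt (j + 1) (by omega) x hx
    have h3 := h1.unique (h2.congr_of_eventuallyEq ?_)
    · push_cast
      linarith
    · filter_upwards [Ioi_mem_nhds hx] with y hy
      exact ih (by omega) hy ((hasDerivAt_id y).sub_const c)

/-- At `b ≠ c` the Leibniz relations determine the derivatives of the quotient recursively, so zeros
at the other nodes keep their multiplicity. -/
theorem remChain_eq_zero (h : IsDerivChain (N + 1) F) (hc : 0 < c) (hFc : F 0 c = 0) {b : ℝ}
    (hb : 0 < b) (hbc : b ≠ c) {m : ℕ} (hm : m ≤ N + 1) (hF : ∀ j < m, F j b = 0) :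
    ∀ j < m, _root_.remChain c F j b = 0 := by
  intro j
  induction j with
  | zero =>
    intro hj
    have := h.sub_mul_remChain_zero hc hb
    rw [hFc, hF 0 hj, sub_zero] at this
    exact (mul_eq_zero.1 this).resolve_left (sub_ne_zero.2 hbc)
  | succ j ih =>
    intro hj
    have := h.sub_mul_remChain_succ hc (show j < N by omega) hb
    rw [ih (by omega), hF _ hj, mul_zero, add_zero] at this
    exact (mul_eq_zero.1 this).resolve_left (sub_ne_zero.2 hbc)

/-- A function that vanishes at the nodes `L`, with multiplicity, is the product of the linear
factors and its divided difference. -/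
theorem eq_prod_mul_remIter {L : List ℝ} {F : ℕ → ℝ → ℝ} (h : IsDerivChain L.length F)
    (hL : ∀ c ∈ L, 0 < c) (hF : ∀ c ∈ L, ∀ j < L.count c, F j c = 0) {x : ℝ} (hx : 0 < x) :
    F 0 x = (L.map (x - ·)).prod * remIter 0 L (F L.length) x := by
  induction L generalizing F with
  | nil => simp [remIter]
  | cons c L ih =>
    have hc := hL c (by simp)
    rw [List.length_cons] at h
    have hFc : F 0 c = 0 := hF c (by simp) 0 (by simp)
    have key := ih (h.remChain hc) (fun d hd => hL d (by simp [hd])) ?_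
    · have := h.sub_mul_remChain_zero hc hx
      rw [hFc, sub_zero] at this
      rw [← this, key]
      simp only [List.map_cons, List.prod_cons, remIter, List.length_cons, zero_add,
        _root_.remChain]
      ring
    · intro b hb
      by_cases hbc : b = c
      -- At the removed node, `remAvg_self` gives `g⁽ʲ⁾(c) = F⁽ʲ⁺¹⁾(c) / (j + 1)`, so exactly one
      -- unit of multiplicity is lost.
      · subst hbc
        intro j hj
        have := hF b (by simp) (j + 1) (by simpa using hj)
        simp [_root_.remChain, remAvg_self, this]
      · apply h.remChain_eq_zero hc hFc (hL b (by simp [hb])) hbc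
        · exact List.count_le_length.trans (by omega)
        · intro j hj
          exact hF b (by simp [hb]) j (by rwa [List.count_cons_of_ne (Ne.symm hbc)])

end IsDerivChain

theorem isDerivChain_polynomial (N : ℕ) (P : Polynomial ℝ) :
    IsDerivChain N fun i x => (Polynomial.derivative^[i] P).eval x :=
  ⟨fun i _ x _ => by
    simpa only [Function.iterate_succ_apply'] using (Polynomial.derivative^[i] P).hasDerivAt x,
    (Polynomial.derivative^[N] P).continuous.continuousOn⟩

theorem ContDiffOn.isDerivChain {N : ℕ} {f : ℝ → ℝ} (hf : ContDiffOn ℝ N f (Ioi 0)) :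
    IsDerivChain N fun i => iteratedDeriv i f := by
  have hopen : ∀ i, EqOn (iteratedDerivWithin i f (Ioi 0)) (iteratedDeriv i f) (Ioi 0) :=
    fun i => iteratedDerivWithin_of_isOpen isOpen_Ioi
  refine ⟨fun i hi x hx => ?_, ?_⟩
  · have h1 := hf.differentiableOn_iteratedDerivWithin (m := i) (by exact_mod_cast hi)
      (uniqueDiffOn_Ioi 0)
    have h2 := ((h1.congr fun y hy => (hopen i hy).symm).differentiableAt
      (Ioi_mem_nhds hx)).hasDerivAt
    simpa only [iteratedDeriv_succ] using h2
  · exact (hf.continuousOn_iteratedDerivWithin le_rfl (uniqueDiffOn_Ioi 0)).congr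
      fun y hy => (hopen N hy).symm

/-! ### Hermite interpolation and its remainder. -/

/-- All interpolation nodes except for one copy of `a`. -/
def hermNodes (r s : ℕ) (a b : ℝ) : List ℝ := List.replicate (s + 1) b ++ List.replicate r a

/-- The divided difference of order `r + s + 2` at `x`, `a` (`r + 1` times) and
`b` (`s + 1` times), as a functional of the derivative `φ` of that order. -/
noncomputable def hermRem (r s : ℕ) (φ : ℝ → ℝ) (a b : ℝ) : ℝ → ℝ :=
  remIter 0 (hermNodes r s a b ++ [a]) φ

theorem length_hermNodes_append (r s : ℕ) (a b : ℝ) :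
    (hermNodes r s a b ++ [a]).length = r + s + 2 := by
  simp [hermNodes]; omega

theorem mem_hermNodes {r s : ℕ} {a b c : ℝ} (h : c ∈ hermNodes r s a b) : c = a ∨ c = b := by
  simp only [hermNodes, List.mem_append, List.mem_replicate] at h
  tauto

theorem mem_hermNodes_append {r s : ℕ} {a b c : ℝ} (h : c ∈ hermNodes r s a b ++ [a]) :
    c = a ∨ c = b := by
  simp only [List.mem_append, List.mem_singleton] at h
  exact h.elim mem_hermNodes Or.inl

theorem IsDerivChain.eq_mul_hermRem {r s : ℕ} {F : ℕ → ℝ → ℝ} (h : IsDerivChain (r + s + 2) F)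
    {a b : ℝ} (ha : 0 < a) (hb : 0 < b) (hab : a ≠ b) (hFa : ∀ j ≤ r, F j a = 0)
    (hFb : ∀ j ≤ s, F j b = 0) {x : ℝ} (hx : 0 < x) :
    F 0 x = (x - a) ^ (r + 1) * (x - b) ^ (s + 1) * hermRem r s (F (r + s + 2)) a b x := by
  have hlen := length_hermNodes_append r s a b
  have := IsDerivChain.eq_prod_mul_remIter (L := hermNodes r s a b ++ [a]) (F := F)
    (by rwa [hlen]) ?_ ?_ hx
  · rw [this, hlen, hermRem]
    simp only [hermNodes, List.map_append, List.map_replicate, List.prod_append,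
      List.prod_replicate, List.map_cons, List.map_nil, List.prod_singleton]
    ring
  · intro c hc
    rcases mem_hermNodes_append hc with rfl | rfl <;> assumption
  · intro c hc
    rcases mem_hermNodes_append hc with rfl | rfl
    · intro j hj
      exact hFa j (by simp [hermNodes, List.count_replicate, hab.symm] at hj; omega)
    · intro j hj
      exact hFb j (by simp [hermNodes, List.count_replicate, hab] at hj; omega)

theorem remIter_zero_fun (i : ℕ) (L : List ℝ) (x : ℝ) : remIter i L (fun _ => 0) x = 0 := by
  simpa using congrFun (remIter_const_mul i L (fun _ => 0) 0) x

/-- The remainder formula applied to `P` itself: its derivative of order `r + s + 2` is zero, so `P`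
vanishes on the whole half-line. -/
theorem Polynomial.eq_zero_of_hermite_data {r s : ℕ} {a b : ℝ} (ha : 0 < a) (hb : 0 < b)
    (hab : a ≠ b) {P : Polynomial ℝ} (hP : P.natDegree ≤ r + s + 1)
    (hPa : ∀ j ≤ r, (Polynomial.derivative^[j] P).eval a = 0)
    (hPb : ∀ j ≤ s, (Polynomial.derivative^[j] P).eval b = 0) : P = 0 := by
  have h0 : Polynomial.derivative^[r + s + 2] P = 0 :=
    Polynomial.iterate_derivative_eq_zero (by omega)
  refine Polynomial.eq_zero_of_infinite_isRoot P ((Ioi_infinite (0 : ℝ)).mono fun x hx => ?_)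
  have := (isDerivChain_polynomial (r + s + 2) P).eq_mul_hermRem ha hb hab hPa hPb hx
  simpa [h0, hermRem, remIter_zero_fun] using this

theorem IsHermiteInterpolant.symm {f : ℝ → ℝ} {r s : ℕ} {a b : ℝ} {P : Polynomial ℝ}
    (h : IsHermiteInterpolant f r s a b P) : IsHermiteInterpolant f s r b a P :=
  ⟨by have := h.1; omega, h.2.2, h.2.1⟩

theorem IsHermiteInterpolant.sub_eq {f : ℝ → ℝ} {r s : ℕ}
    (hf : ContDiffOn ℝ (r + s + 2 : ℕ) f (Ioi 0)) {a b : ℝ} (ha : 0 < a) (hb : 0 < b)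
    (hab : a ≠ b) {P : Polynomial ℝ} (h : IsHermiteInterpolant f r s a b P) {x : ℝ} (hx : 0 < x) :
    f x - P.eval x = (x - a) ^ (r + 1) * (x - b) ^ (s + 1) *
      hermRem r s (iteratedDeriv (r + s + 2) f) a b x := by
  have h0 : Polynomial.derivative^[r + s + 2] P = 0 :=
    Polynomial.iterate_derivative_eq_zero (by have := h.1; omega)
  have := (hf.isDerivChain.sub (isDerivChain_polynomial (r + s + 2) P)).eq_mul_hermRem ha hb hab
    (fun j hj => by simp [h.2.1 j hj]) (fun j hj => by simp [h.2.2 j hj]) hx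
  simpa [h0] using this

/-- The linear map from polynomials to Hermite data is injective, and both spaces have dimension `r
+ s + 2`. -/
theorem exists_isHermiteInterpolant (f : ℝ → ℝ) (r s : ℕ) {a b : ℝ} (ha : 0 < a) (hb : 0 < b)
    (hab : a ≠ b) : ∃ P, IsHermiteInterpolant f r s a b P := by
  let ev : (j : ℕ) → (c : ℝ) → Polynomial.degreeLT ℝ (r + s + 2) →ₗ[ℝ] ℝ := fun j c =>
    (Polynomial.leval c ∘ₗ (Polynomial.derivative ^ j : Module.End ℝ (Polynomial ℝ))) ∘ₗ
      (Polynomial.degreeLT ℝ (r + s + 2)).subtype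
  have hev : ∀ j c P, ev j c P = (Polynomial.derivative^[j] (P : Polynomial ℝ)).eval c := by
    intro j c P
    simp [ev, Module.End.pow_apply, Polynomial.leval]
  let T : Polynomial.degreeLT ℝ (r + s + 2) →ₗ[ℝ] (Fin (r + 1) → ℝ) × (Fin (s + 1) → ℝ) :=
    (LinearMap.pi fun j : Fin (r + 1) => ev j a).prod (LinearMap.pi fun j : Fin (s + 1) => ev j b)
  have hdeg : ∀ P : Polynomial.degreeLT ℝ (r + s + 2),
      (P : Polynomial ℝ).natDegree ≤ r + s + 1 := fun P => by
    have := Polynomial.mem_degreeLT.1 P.2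
    rw [Polynomial.natDegree_le_iff_degree_le]
    exact Order.le_of_lt_succ (by exact_mod_cast this)
  have hinj : Function.Injective T := by
    rw [← LinearMap.ker_eq_bot, LinearMap.ker_eq_bot']
    intro P hP
    have h1 : ∀ j : Fin (r + 1), ev j a P = 0 := fun j => congrFun (congrArg Prod.fst hP) j
    have h2 : ∀ j : Fin (s + 1), ev j b P = 0 := fun j => congrFun (congrArg Prod.snd hP) j
    apply Subtype.ext
    refine Polynomial.eq_zero_of_hermite_data ha hb hab (hdeg P) (fun j hj => ?_) fun j hj => ?_
    · rw [← hev]; exact h1 ⟨j, by omega⟩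
    · rw [← hev]; exact h2 ⟨j, by omega⟩
  have hfin : Module.finrank ℝ (Polynomial.degreeLT ℝ (r + s + 2)) =
      Module.finrank ℝ ((Fin (r + 1) → ℝ) × (Fin (s + 1) → ℝ)) := by
    rw [(Polynomial.degreeLTEquiv ℝ (r + s + 2)).finrank_eq]
    simp
    omega
  have : FiniteDimensional ℝ (Polynomial.degreeLT ℝ (r + s + 2)) :=
    (Polynomial.degreeLTEquiv ℝ (r + s + 2)).symm.finiteDimensional
  obtain ⟨P, hP⟩ := (LinearMap.injective_iff_surjective_of_finrank_eq_finrank hfin).1 hinj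
    (fun j => iteratedDeriv j f a, fun j => iteratedDeriv j f b)
  refine ⟨P, hdeg P, fun j hj => ?_, fun j hj => ?_⟩
  · rw [← hev]; exact congrFun (congrArg Prod.fst hP) (⟨j, by omega⟩ : Fin (r + 1))
  · rw [← hev]; exact congrFun (congrArg Prod.snd hP) (⟨j, by omega⟩ : Fin (s + 1))

/-! ### The crossing equation as the zero set of a monotone function. -/

/-- The function whose zeros in `(a, b)` are the crossings. -/
noncomputable def crossFun (m₁ m₂ : ℕ) (φ : ℝ → ℝ) (a b x : ℝ) : ℝ :=
  (x - a) ^ (m₁ - m₂) * hermRem m₁ m₂ φ a b x - (b - x) ^ (m₁ - m₂) * hermRem m₁ m₂ φ b a x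

theorem isHermiteCrossing_iff {f : ℝ → ℝ} {m₁ m₂ : ℕ} (hm : m₂ < m₁)
    (hf : ContDiffOn ℝ (m₁ + m₂ + 2 : ℕ) f (Ioi 0)) {a b x : ℝ} (ha : 0 < a)
    (hx : x ∈ Ioo a b) :
    IsHermiteCrossing f m₁ m₂ a b x ↔
      crossFun m₁ m₂ (iteratedDeriv (m₁ + m₂ + 2) f) a b x = 0 := by
  obtain ⟨k, rfl⟩ := Nat.exists_eq_add_of_lt hm
  set φ := iteratedDeriv (m₂ + k + 1 + m₂ + 2) f
  have hxa := sub_pos.2 hx.1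
  have hxb := sub_neg.2 hx.2
  have hab : a < b := hx.1.trans hx.2
  have hb : 0 < b := ha.trans hab
  have hx0 : 0 < x := ha.trans hx.1
  have hk : m₂ + k + 1 - m₂ = k + 1 := by omega
  have hw : (x - a) ^ (m₂ + 1) * (x - b) ^ (m₂ + 1) ≠ 0 :=
    mul_ne_zero (pow_ne_zero _ hxa.ne') (pow_ne_zero _ hxb.ne)
  have hP : ∀ P, IsHermiteInterpolant f (m₂ + k + 1) m₂ a b P → f x - P.eval x =
      (x - a) ^ (m₂ + 1) * (x - b) ^ (m₂ + 1) *
        ((x - a) ^ (k + 1) * hermRem (m₂ + k + 1) m₂ φ a b x) := fun P h => by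
    rw [h.sub_eq hf ha hb hab.ne hx0]; ring
  have hQ : ∀ Q, IsHermiteInterpolant f m₂ (m₂ + k + 1) a b Q → f x - Q.eval x =
      (x - a) ^ (m₂ + 1) * (x - b) ^ (m₂ + 1) *
        ((x - b) ^ (k + 1) * hermRem (m₂ + k + 1) m₂ φ b a x) := fun Q h => by
    rw [h.symm.sub_eq hf hb ha hab.ne' hx0]; ring
  unfold IsHermiteCrossing crossFun
  rw [hk]
  have key : ∀ P Q, IsHermiteInterpolant f (m₂ + k + 1) m₂ a b P →
      IsHermiteInterpolant f m₂ (m₂ + k + 1) a b Q →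
      (((Even (k + 1) → P.eval x = Q.eval x) ∧
        (Odd (k + 1) → f x = (P.eval x + Q.eval x) / 2)) ↔
      (x - a) ^ (k + 1) * hermRem (m₂ + k + 1) m₂ φ a b x -
        (b - x) ^ (k + 1) * hermRem (m₂ + k + 1) m₂ φ b a x = 0) := by
    intro P Q h1 h2
    have e1 := hP P h1
    have e2 := hQ Q h2
    have hz : ∀ z : ℝ, z = 0 ↔ (x - a) ^ (m₂ + 1) * (x - b) ^ (m₂ + 1) * z = 0 := fun z => by
      rw [mul_eq_zero, or_iff_right hw]
    rw [hz, mul_sub]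
    -- The equations read `f - P = f - Q` and `f - P = -(f - Q)`; the sign is absorbed by `(x - b) ^
    -- (k + 1) = ± (b - x) ^ (k + 1)`.
    rcases Nat.even_or_odd (k + 1) with h | h
    · have h' : ¬ Odd (k + 1) := Nat.not_odd_iff_even.2 h
      rw [show (x - b) ^ (k + 1) = (b - x) ^ (k + 1) by rw [← neg_sub b x, h.neg_pow]] at e2
      simp only [h, h', true_imp_iff, false_imp_iff, and_true]
      constructor <;> intro H <;> linarith
    · have h' : ¬ Even (k + 1) := Nat.not_even_iff_odd.2 h
      rw [show (x - b) ^ (k + 1) = -(b - x) ^ (k + 1) by rw [← neg_sub b x, h.neg_pow],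
        neg_mul, mul_neg] at e2
      simp only [h, h', true_imp_iff, false_imp_iff, true_and]
      constructor <;> intro H <;> linarith
  constructor
  · rintro ⟨P, Q, h1, h2, h3⟩
    exact (key P Q h1 h2).1 h3
  · intro H
    obtain ⟨P, h1⟩ := exists_isHermiteInterpolant f (m₂ + k + 1) m₂ ha hb hab.ne
    obtain ⟨Q, h2⟩ := exists_isHermiteInterpolant f m₂ (m₂ + k + 1) ha hb hab.ne
    exact ⟨P, Q, h1, h2, (key P Q h1 h2).2 H⟩

section HermRem

variable {r s : ℕ} {φ : ℝ → ℝ} {a b : ℝ}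

theorem hermNodes_pos (ha : 0 < a) (hb : 0 < b) : ∀ c ∈ hermNodes r s a b, 0 < c := fun c hc => by
  rcases mem_hermNodes hc with rfl | rfl <;> assumption

theorem hermNodes_append_pos (ha : 0 < a) (hb : 0 < b) : ∀ c ∈ hermNodes r s a b ++ [a], 0 < c :=
  fun c hc => by rcases mem_hermNodes_append hc with rfl | rfl <;> assumption

theorem hermRem_pos (hφ : ContinuousOn φ (Ioi 0)) (h : ∀ y, 0 < y → 0 < φ y) (ha : 0 < a)
    (hb : 0 < b) {x : ℝ} (hx : 0 < x) : 0 < hermRem r s φ a b x :=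
  remIter_pos 0 (hermNodes_append_pos ha hb) hφ h hx

/-- With one copy of `a` peeled off, the function is `∫ t in a..x` of an iterated average of `φ`,
which is positive. -/
theorem strictMonoOn_sub_mul_hermRem (hφ : ContinuousOn φ (Ioi 0)) (h : ∀ y, 0 < y → 0 < φ y)
    (ha : 0 < a) (hb : 0 < b) :
    StrictMonoOn (fun x => (x - a) * hermRem r s φ a b x) (Ioi 0) := by
  intro x hx y hy hxy
  have hψ := continuousOn_remIter 1 (hermNodes_pos (r := r) (s := s) ha hb) hφ
  have hint : ∀ u v : ℝ, 0 < u → 0 < v →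
      IntervalIntegrable (remIter 1 (hermNodes r s a b) φ) volume u v := fun u v hu hv =>
    (hψ.mono fun t ht => (lt_min hu hv).trans_le ht.1).intervalIntegrable
  simp only [hermRem, remIter_append, mul_remAvg_zero]
  rw [← sub_pos, intervalIntegral.integral_interval_sub_left (hint _ _ ha hy) (hint _ _ ha hx)]
  exact intervalIntegral.intervalIntegral_pos_of_pos_on (hint _ _ hx hy)
    (fun t ht => remIter_pos 1 (hermNodes_pos ha hb) hφ h (lt_trans hx ht.1)) hxy

theorem continuousOn_hermRem_param (r s : ℕ) (hφ : ContinuousOn φ (Ioi 0)) :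
    ContinuousOn (fun p : (ℝ × ℝ) × ℝ => hermRem r s φ p.1.1 p.1.2 p.2)
      ({z | 0 < z.1 ∧ 0 < z.2} ×ˢ Ioi 0) := by
  have := continuousOn_remIter_param (Z := ℝ × ℝ) (U := {z | 0 < z.1 ∧ 0 < z.2}) 0
    (List.replicate (s + 1) Prod.snd ++ List.replicate r Prod.fst ++ [Prod.fst]) ?_
    (Φ := fun _ => φ) (hφ.comp continuousOn_snd fun p hp => hp.2)
  · simpa [hermRem, hermNodes] using this
  · intro c hc
    simp only [List.mem_append, List.mem_replicate, List.mem_singleton] at hc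
    rcases hc with (⟨-, rfl⟩ | ⟨-, rfl⟩) | rfl
    · exact ⟨continuousOn_snd, fun z hz => hz.2⟩
    · exact ⟨continuousOn_fst, fun z hz => hz.1⟩
    · exact ⟨continuousOn_fst, fun z hz => hz.1⟩

end HermRem

section CrossFun

variable {m₁ m₂ : ℕ} {φ : ℝ → ℝ} {a b : ℝ}

theorem continuousOn_crossFun_param (m₁ m₂ : ℕ) (hφ : ContinuousOn φ (Ioi 0)) :
    ContinuousOn (fun p : (ℝ × ℝ) × ℝ => crossFun m₁ m₂ φ p.1.1 p.1.2 p.2)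
      ({z | 0 < z.1 ∧ 0 < z.2} ×ˢ Ioi 0) := by
  have h1 := continuousOn_hermRem_param m₁ m₂ hφ
  have h2 := h1.comp (f := fun p : (ℝ × ℝ) × ℝ => ((p.1.2, p.1.1), p.2)) (by fun_prop)
    (s := {z | 0 < z.1 ∧ 0 < z.2} ×ˢ Ioi 0) fun p hp => ⟨⟨hp.1.2, hp.1.1⟩, hp.2⟩
  unfold crossFun
  exact ((by fun_prop : Continuous fun p : (ℝ × ℝ) × ℝ =>
    (p.2 - p.1.1) ^ (m₁ - m₂)).continuousOn.mul h1).sub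
    ((by fun_prop : Continuous fun p : (ℝ × ℝ) × ℝ =>
      (p.1.2 - p.2) ^ (m₁ - m₂)).continuousOn.mul h2)

theorem crossFun_congr {ψ : ℝ → ℝ} (h : EqOn φ ψ (Ioi 0)) (ha : 0 < a) (hb : 0 < b) {x : ℝ}
    (hx : 0 < x) : crossFun m₁ m₂ φ a b x = crossFun m₁ m₂ ψ a b x := by
  simp only [crossFun, hermRem, remIter_congr 0 (hermNodes_append_pos ha hb) h hx,
    remIter_congr 0 (hermNodes_append_pos hb ha) h hx]

theorem crossFun_const_mul (C a b x : ℝ) :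
    crossFun m₁ m₂ (fun y => C * φ y) a b x = C * crossFun m₁ m₂ φ a b x := by
  simp only [crossFun, hermRem, remIter_const_mul]
  ring

theorem hermRem_scale (r s : ℕ) (φ : ℝ → ℝ) (k a b x : ℝ) :
    hermRem r s φ (k * a) (k * b) (k * x) = hermRem r s (fun y => φ (k * y)) a b x := by
  have := congrFun (remIter_scale 0 (hermNodes r s a b ++ [a]) φ k) x
  simpa [hermRem, hermNodes] using this

theorem crossFun_scale (k a b x : ℝ) : crossFun m₁ m₂ φ (k * a) (k * b) (k * x) =
    k ^ (m₁ - m₂) * crossFun m₁ m₂ (fun y => φ (k * y)) a b x := by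
  simp only [crossFun, hermRem_scale, ← mul_sub, mul_pow]
  ring

/-- One linear factor is kept with `hermRem` to get strict monotonicity; the remaining `k` factors
are only needed to be monotone and nonnegative. The second term is the mirror image. -/
theorem strictMonoOn_crossFun (hm : m₂ < m₁) (hφ : ContinuousOn φ (Ioi 0))
    (h : ∀ y, 0 < y → 0 < φ y) (ha : 0 < a) (hab : a < b) :
    StrictMonoOn (crossFun m₁ m₂ φ a b) (Icc a b) := by
  obtain ⟨k, rfl⟩ := Nat.exists_eq_add_of_lt hm
  have hb := ha.trans hab
  intro x hx y hy hxy
  have hx0 := ha.trans_le hx.1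
  have hy0 := ha.trans_le hy.1
  unfold crossFun
  rw [show m₂ + k + 1 - m₂ = k + 1 by omega]
  have h1 := strictMonoOn_sub_mul_hermRem (r := m₂ + k + 1) (s := m₂) hφ h ha hb hx0 hy0 hxy
  have h2 := strictMonoOn_sub_mul_hermRem (r := m₂ + k + 1) (s := m₂) hφ h hb ha hx0 hy0 hxy
  simp only at h1 h2
  have p1 : (x - a) ^ k ≤ (y - a) ^ k := by
    have := hx.1; gcongr
  have p2 : (b - y) ^ k ≤ (b - x) ^ k := by
    have := hy.2; gcongr
  have p3 : 0 < (y - a) ^ k := pow_pos (by linarith [hx.1]) k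
  have p4 : 0 ≤ (b - x) ^ k := pow_nonneg (by linarith [hx.2]) k
  have q1 : 0 ≤ (x - a) * hermRem (m₂ + k + 1) m₂ φ a b x :=
    mul_nonneg (by linarith [hx.1]) (hermRem_pos hφ h ha hb hx0).le
  have q2 : 0 ≤ (b - y) * hermRem (m₂ + k + 1) m₂ φ b a y :=
    mul_nonneg (by linarith [hy.2]) (hermRem_pos hφ h hb ha hy0).le
  have r1 : (x - a) ^ k * ((x - a) * hermRem (m₂ + k + 1) m₂ φ a b x) <
      (y - a) ^ k * ((y - a) * hermRem (m₂ + k + 1) m₂ φ a b y) :=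
    (mul_le_mul_of_nonneg_right p1 q1).trans_lt (mul_lt_mul_of_pos_left h1 p3)
  have r2 : (b - y) ^ k * ((b - y) * hermRem (m₂ + k + 1) m₂ φ b a y) ≤
      (b - x) ^ k * ((b - x) * hermRem (m₂ + k + 1) m₂ φ b a x) :=
    (mul_le_mul_of_nonneg_right p2 q2).trans (mul_le_mul_of_nonneg_left (by linarith) p4)
  rw [pow_succ, pow_succ, pow_succ, pow_succ]
  linarith

theorem exists_crossFun_eq_zero (hm : m₂ < m₁) (hφ : ContinuousOn φ (Ioi 0))
    (h : ∀ y, 0 < y → 0 < φ y) (ha : 0 < a) (hab : a < b) :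
    ∃ x ∈ Ioo a b, crossFun m₁ m₂ φ a b x = 0 := by
  have hb := ha.trans hab
  have hk : m₁ - m₂ ≠ 0 := by omega
  have hc : ContinuousOn (crossFun m₁ m₂ φ a b) (Icc a b) :=
    (continuousOn_crossFun_param m₁ m₂ hφ).comp (f := fun x : ℝ => ((a, b), x)) (by fun_prop)
      fun x hx => ⟨⟨ha, hb⟩, ha.trans_le hx.1⟩
  have h1 : crossFun m₁ m₂ φ a b a < 0 := by
    simp only [crossFun, sub_self, zero_pow hk, zero_mul, zero_sub, neg_lt_zero]
    exact mul_pos (pow_pos (sub_pos.2 hab) _) (hermRem_pos hφ h hb ha ha)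
  have h2 : 0 < crossFun m₁ m₂ φ a b b := by
    simp only [crossFun, sub_self, zero_pow hk, zero_mul, sub_zero]
    exact mul_pos (pow_pos (sub_pos.2 hab) _) (hermRem_pos hφ h ha hb hb)
  exact intermediate_value_Ioo hab.le hc ⟨h1, h2⟩

end CrossFun

/-! ### Existence, continuity and homogeneity of the mean. -/

theorem hermiteMean_comm (f : ℝ → ℝ) (m₁ m₂ : ℕ) (a b : ℝ) :
    hermiteMean f m₁ m₂ a b = hermiteMean f m₁ m₂ b a := by
  by_cases h : a = b
  · rw [h]
  · unfold hermiteMean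
    rw [if_neg h, if_neg (Ne.symm h), min_comm b a, max_comm b a]

theorem hermiteMean_self (f : ℝ → ℝ) (m₁ m₂ : ℕ) (a : ℝ) : hermiteMean f m₁ m₂ a a = a := by
  simp [hermiteMean]

theorem hermiteMean_eq {f : ℝ → ℝ} {m₁ m₂ : ℕ} {a b x : ℝ} (hx : x ∈ Ioo a b)
    (hc : IsHermiteCrossing f m₁ m₂ a b x)
    (hu : ∀ y ∈ Ioo a b, IsHermiteCrossing f m₁ m₂ a b y → y = x) :
    hermiteMean f m₁ m₂ a b = x := by
  have hab : a < b := hx.1.trans hx.2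
  have h : ∃! x, x ∈ Ioo (min a b) (max a b) ∧
      IsHermiteCrossing f m₁ m₂ (min a b) (max a b) x := by
    rw [min_eq_left hab.le, max_eq_right hab.le]
    exact ⟨x, ⟨hx, hc⟩, fun y hy => hu y hy.1 hy.2⟩
  unfold hermiteMean
  rw [if_neg hab.ne, dif_pos h]
  have := h.choose_spec.1
  generalize Exists.choose h = y at this ⊢
  rw [min_eq_left hab.le, max_eq_right hab.le] at this
  exact hu _ this.1 this.2

/-- The crossings of `f` are the zeros of the functions `crossFun m₁ m₂ φ a b`. -/
def CrossesLike (f : ℝ → ℝ) (m₁ m₂ : ℕ) (φ : ℝ → ℝ) : Prop :=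
  ∀ a b x : ℝ, 0 < a → x ∈ Ioo a b →
    (IsHermiteCrossing f m₁ m₂ a b x ↔ crossFun m₁ m₂ φ a b x = 0)

/-- A nonzero factor `C`, of either sign, does not move the zeros, so `φ` may be taken positive
afterwards. -/
theorem crossesLike_of_iteratedDeriv {f : ℝ → ℝ} {m₁ m₂ : ℕ} (hm : m₂ < m₁)
    (hf : ContDiffOn ℝ (m₁ + m₂ + 2 : ℕ) f (Ioi 0)) {φ : ℝ → ℝ} {C : ℝ} (hC : C ≠ 0)
    (h : ∀ x, 0 < x → iteratedDeriv (m₁ + m₂ + 2) f x = C * φ x) : CrossesLike f m₁ m₂ φ := by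
  intro a b x ha hx
  rw [isHermiteCrossing_iff hm hf ha hx, crossFun_congr (ψ := fun y => C * φ y) (fun y hy => h y hy)
    ha (ha.trans (hx.1.trans hx.2)) (ha.trans hx.1), crossFun_const_mul, mul_eq_zero,
    or_iff_right hC]

namespace CrossesLike

variable {f g : ℝ → ℝ} {m₁ m₂ : ℕ} {φ : ℝ → ℝ} {a b x : ℝ}

theorem hermiteMean_eq (hf : CrossesLike f m₁ m₂ φ) (hm : m₂ < m₁)
    (hφ : ContinuousOn φ (Ioi 0)) (h : ∀ y, 0 < y → 0 < φ y) (ha : 0 < a) (hx : x ∈ Ioo a b)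
    (hc : crossFun m₁ m₂ φ a b x = 0) : hermiteMean f m₁ m₂ a b = x := by
  refine _root_.hermiteMean_eq hx ((hf a b x ha hx).2 hc) fun y hy hyc => ?_
  exact (strictMonoOn_crossFun hm hφ h ha (hx.1.trans hx.2)).injOn (Ioo_subset_Icc_self hy)
    (Ioo_subset_Icc_self hx) (by rw [hc, (hf a b y ha hy).1 hyc])

theorem hermiteMean_spec (hf : CrossesLike f m₁ m₂ φ) (hm : m₂ < m₁)
    (hφ : ContinuousOn φ (Ioi 0)) (h : ∀ y, 0 < y → 0 < φ y) (ha : 0 < a) (hab : a < b) :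
    hermiteMean f m₁ m₂ a b ∈ Ioo a b ∧
      crossFun m₁ m₂ φ a b (hermiteMean f m₁ m₂ a b) = 0 := by
  obtain ⟨x, hx, hc⟩ := exists_crossFun_eq_zero hm hφ h ha hab
  rw [hf.hermiteMean_eq hm hφ h ha hx hc]
  exact ⟨hx, hc⟩

theorem hermiteMean_eq_hermiteMean (hf : CrossesLike f m₁ m₂ φ) (hg : CrossesLike g m₁ m₂ φ)
    (hm : m₂ < m₁) (hφ : ContinuousOn φ (Ioi 0)) (h : ∀ y, 0 < y → 0 < φ y) (ha : 0 < a)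
    (hb : 0 < b) : hermiteMean f m₁ m₂ a b = hermiteMean g m₁ m₂ a b := by
  have key : ∀ a b, 0 < a → a < b → hermiteMean f m₁ m₂ a b = hermiteMean g m₁ m₂ a b :=
    fun a b ha hab => by
      obtain ⟨h1, h2⟩ := hg.hermiteMean_spec hm hφ h ha hab
      exact hf.hermiteMean_eq hm hφ h ha h1 h2
  rcases lt_trichotomy a b with hab | rfl | hab
  · exact key a b ha hab
  · simp only [hermiteMean_self]
  · rw [hermiteMean_comm f, hermiteMean_comm g]
    exact key b a hb hab

theorem min_le_hermiteMean_le_max (hf : CrossesLike f m₁ m₂ φ) (hm : m₂ < m₁)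
    (hφ : ContinuousOn φ (Ioi 0)) (h : ∀ y, 0 < y → 0 < φ y) (ha : 0 < a) (hb : 0 < b) :
    min a b ≤ hermiteMean f m₁ m₂ a b ∧ hermiteMean f m₁ m₂ a b ≤ max a b := by
  rcases lt_trichotomy a b with hab | rfl | hab
  · rw [min_eq_left hab.le, max_eq_right hab.le]
    have := (hf.hermiteMean_spec hm hφ h ha hab).1
    exact ⟨this.1.le, this.2.le⟩
  · simp [hermiteMean_self]
  · rw [min_eq_right hab.le, max_eq_left hab.le, hermiteMean_comm]
    have := (hf.hermiteMean_spec hm hφ h hb hab).1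
    exact ⟨this.1.le, this.2.le⟩

/-- At a fixed `y` on either side of the mean, the sign of `crossFun` persists for nearby endpoints;
monotonicity then keeps the mean on its side of `y`. -/
theorem continuousAt_hermiteMean_of_lt (hf : CrossesLike f m₁ m₂ φ) (hm : m₂ < m₁)
    (hφ : ContinuousOn φ (Ioi 0)) (h : ∀ y, 0 < y → 0 < φ y) (ha : 0 < a) (hab : a < b) :
    ContinuousAt (fun z : ℝ × ℝ => hermiteMean f m₁ m₂ z.1 z.2) (a, b) := by
  obtain ⟨hx, hc⟩ := hf.hermiteMean_spec hm hφ h ha hab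
  have hmono := strictMonoOn_crossFun hm hφ h ha hab
  have hcont : ∀ y, 0 < y → ContinuousAt (fun z : ℝ × ℝ => crossFun m₁ m₂ φ z.1 z.2 y) (a, b) := by
    intro y hy
    have hopen : IsOpen ({z : ℝ × ℝ | 0 < z.1 ∧ 0 < z.2} ×ˢ Ioi (0 : ℝ)) :=
      ((isOpen_lt continuous_const continuous_fst).inter
        (isOpen_lt continuous_const continuous_snd)).prod isOpen_Ioi
    have := (continuousOn_crossFun_param m₁ m₂ hφ).continuousAt
      (hopen.mem_nhds (x := ((a, b), y)) ⟨⟨ha, ha.trans hab⟩, hy⟩)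
    exact this.comp (f := fun z : ℝ × ℝ => (z, y)) (by fun_prop)
  have hfst : ∀ {l u : ℝ}, l < a → a < u → ∀ᶠ z : ℝ × ℝ in 𝓝 (a, b), l < z.1 ∧ z.1 < u :=
    fun hl hu => (continuous_fst.tendsto (a, b)).eventually (Ioo_mem_nhds hl hu)
  have hsnd : ∀ {l : ℝ}, l < b → ∀ᶠ z : ℝ × ℝ in 𝓝 (a, b), l < z.2 :=
    fun hl => (continuous_snd.tendsto (a, b)).eventually (Ioi_mem_nhds hl)
  refine tendsto_order.2 ⟨fun l hl => ?_, fun u hu => ?_⟩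
  · obtain ⟨y, hy1, hy2⟩ := exists_between (max_lt hl hx.1)
    have hay := (le_max_right _ _).trans_lt hy1
    have hneg : crossFun m₁ m₂ φ a b y < 0 :=
      hc ▸ hmono ⟨hay.le, (hy2.trans hx.2).le⟩ (Ioo_subset_Icc_self hx) hy2
    filter_upwards [(hcont y (ha.trans hay)).eventually_lt_const hneg, hfst ha hay,
      hsnd (hy2.trans hx.2)] with z hz h1 h2
    obtain ⟨hzx, hzc⟩ := hf.hermiteMean_spec hm hφ h h1.1 (h1.2.trans h2)
    refine ((le_max_left _ _).trans_lt hy1).trans (lt_of_not_ge fun hle => ?_)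
    have := (strictMonoOn_crossFun hm hφ h h1.1 (h1.2.trans h2)).monotoneOn
      (Ioo_subset_Icc_self hzx) ⟨h1.2.le, h2.le⟩ hle
    linarith
  · obtain ⟨y, hy1, hy2⟩ := exists_between (lt_min hu hx.2)
    have hyb := hy2.trans_le (min_le_right _ _)
    have hay := hx.1.trans hy1
    have hpos : 0 < crossFun m₁ m₂ φ a b y :=
      hc ▸ hmono (Ioo_subset_Icc_self hx) ⟨hay.le, hyb.le⟩ hy1
    filter_upwards [(hcont y (ha.trans hay)).eventually_const_lt hpos, hfst ha hay,
      hsnd hyb] with z hz h1 h2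
    obtain ⟨hzx, hzc⟩ := hf.hermiteMean_spec hm hφ h h1.1 (h1.2.trans h2)
    refine lt_of_lt_of_le (lt_of_not_ge fun hle => ?_) (hy2.le.trans (min_le_left _ _))
    have := (strictMonoOn_crossFun hm hφ h h1.1 (h1.2.trans h2)).monotoneOn
      ⟨h1.2.le, h2.le⟩ (Ioo_subset_Icc_self hzx) hle
    linarith

theorem isMean (hf : CrossesLike f m₁ m₂ φ) (hm : m₂ < m₁)
    (hφ : ContinuousOn φ (Ioi 0)) (h : ∀ y, 0 < y → 0 < φ y) :
    IsMean (hermiteMean f m₁ m₂) := by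
  refine ⟨?_, fun a b ha hb => hf.min_le_hermiteMean_le_max hm hφ h ha hb⟩
  rintro ⟨a, b⟩ ⟨ha, hb⟩
  simp only at ha hb
  rcases lt_trichotomy a b with hab | rfl | hab
  · exact (hf.continuousAt_hermiteMean_of_lt hm hφ h ha hab).continuousWithinAt
  · have h1 : Tendsto (fun z : ℝ × ℝ => min z.1 z.2) (𝓝[{z | 0 < z.1 ∧ 0 < z.2}] (a, a))
        (𝓝 a) := by
      have : ContinuousAt (fun z : ℝ × ℝ => min z.1 z.2) (a, a) := by fun_prop
      simpa [ContinuousAt] using this.continuousWithinAt (s := {z : ℝ × ℝ | 0 < z.1 ∧ 0 < z.2}).tendsto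
    have h2 : Tendsto (fun z : ℝ × ℝ => max z.1 z.2) (𝓝[{z | 0 < z.1 ∧ 0 < z.2}] (a, a))
        (𝓝 a) := by
      have : ContinuousAt (fun z : ℝ × ℝ => max z.1 z.2) (a, a) := by fun_prop
      simpa [ContinuousAt] using this.continuousWithinAt (s := {z : ℝ × ℝ | 0 < z.1 ∧ 0 < z.2}).tendsto
    unfold ContinuousWithinAt
    simp only [hermiteMean_self]
    -- On the diagonal the mean is squeezed between `min` and `max`.
    refine tendsto_of_tendsto_of_tendsto_of_le_of_le' h1 h2 ?_ ?_
    · filter_upwards [self_mem_nhdsWithin] with z hz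
      exact (hf.min_le_hermiteMean_le_max hm hφ h hz.1 hz.2).1
    · filter_upwards [self_mem_nhdsWithin] with z hz
      exact (hf.min_le_hermiteMean_le_max hm hφ h hz.1 hz.2).2
  · refine ContinuousAt.continuousWithinAt ?_
    have := (hf.continuousAt_hermiteMean_of_lt hm hφ h hb hab)
    have := ContinuousAt.comp (f := Prod.swap) (x := (a, b)) this continuous_swap.continuousAt
    refine this.congr (Eventually.of_forall fun z => ?_)
    exact hermiteMean_comm f m₁ m₂ _ _

theorem isHomogeneousMean_of_rpow {p : ℝ} (hf : CrossesLike f m₁ m₂ fun x => x ^ p)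
    (hm : m₂ < m₁) : IsHomogeneousMean (hermiteMean f m₁ m₂) := by
  have hφ : ContinuousOn (fun x : ℝ => x ^ p) (Ioi 0) := fun x hx =>
    (Real.continuousAt_rpow_const x p (Or.inl (ne_of_gt hx))).continuousWithinAt
  have h : ∀ y : ℝ, 0 < y → 0 < y ^ p := fun y hy => Real.rpow_pos_of_pos hy p
  refine ⟨hf.isMean hm hφ h, ?_⟩
  have key : ∀ k a b : ℝ, 0 < k → 0 < a → a < b →
      hermiteMean f m₁ m₂ (k * a) (k * b) = k * hermiteMean f m₁ m₂ a b := by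
    intro k a b hk ha hab
    obtain ⟨hx, hc⟩ := hf.hermiteMean_spec hm hφ h ha hab
    refine hf.hermiteMean_eq hm hφ h (mul_pos hk ha)
      ⟨mul_lt_mul_of_pos_left hx.1 hk, mul_lt_mul_of_pos_left hx.2 hk⟩ ?_
    rw [crossFun_scale, crossFun_congr (ψ := fun y => k ^ p * y ^ p)
      (fun y hy => Real.mul_rpow hk.le (le_of_lt hy)) ha (ha.trans hab) (ha.trans hx.1),
      crossFun_const_mul, hc, mul_zero, mul_zero]
  intro k a b hk ha hb
  rcases lt_trichotomy a b with hab | rfl | hab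
  · exact key k a b hk ha hab
  · simp only [hermiteMean_self]
  · rw [hermiteMean_comm, hermiteMean_comm f m₁ m₂ a b]
    exact key k b a hk hb hab

end CrossesLike

/-! ### Derivatives of the power functions. -/

section PowerFun

theorem deriv_eq_of_eqOn_Ioi {g h : ℝ → ℝ} (hgh : EqOn g h (Ioi 0)) {x h' : ℝ} (hx : 0 < x)
    (hh : HasDerivAt h h' x) : deriv g x = h' := by
  rw [EventuallyEq.deriv_eq (f := h) (by filter_upwards [Ioi_mem_nhds hx] with y hy using hgh hy)]
  exact hh.deriv

theorem iteratedDeriv_add_eq_rpow {g : ℝ → ℝ} {i : ℕ} {C p : ℝ} (hC : C ≠ 0)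
    (hg : ∀ x, 0 < x → iteratedDeriv i g x = C * x ^ p) (m : ℕ) (hp : ∀ l : ℕ, l < m → p ≠ l) :
    ∃ C' : ℝ, C' ≠ 0 ∧ ∀ x, 0 < x → iteratedDeriv (i + m) g x = C' * x ^ (p - m) := by
  induction m with
  | zero => exact ⟨C, hC, by simpa using hg⟩
  | succ m ih =>
    obtain ⟨C', hC', h⟩ := ih fun l hl => hp l (by omega)
    refine ⟨C' * (p - m), mul_ne_zero hC' (sub_ne_zero.2 (hp m (by omega))), fun x hx => ?_⟩
    rw [← add_assoc, iteratedDeriv_succ]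
    rw [deriv_eq_of_eqOn_Ioi (fun y hy => h y hy) hx
      ((Real.hasDerivAt_rpow_const (Or.inl hx.ne')).const_mul C')]
    push_cast
    rw [sub_sub, mul_assoc]

/-- The case `i = k` leaves `α log x + β` with `α ≠ 0`, and one more derivative leaves a pure power
`α / x`. -/
theorem iteratedDeriv_rpow_mul_log (k i : ℕ) (hi : i ≤ k) : ∃ α β : ℝ, α ≠ 0 ∧ ∀ x : ℝ, 0 < x →
    iteratedDeriv i (fun x : ℝ => x ^ (k : ℝ) * Real.log x) x =
      α * (x ^ ((k : ℝ) - i) * Real.log x) + β * x ^ ((k : ℝ) - i) := by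
  induction i with
  | zero => exact ⟨1, 0, one_ne_zero, fun x _ => by simp⟩
  | succ i ih =>
    obtain ⟨α, β, hα, h⟩ := ih (by omega)
    have hki : ((k : ℝ) - i) ≠ 0 := sub_ne_zero.2 (by exact_mod_cast (show k ≠ i by omega))
    refine ⟨α * (k - i), α + β * (k - i), mul_ne_zero hα hki, fun x hx => ?_⟩
    have hpow := Real.hasDerivAt_rpow_const (p := (k : ℝ) - i) (Or.inl hx.ne')
    rw [iteratedDeriv_succ, deriv_eq_of_eqOn_Ioi (fun y hy => h y hy) hx
      (((hpow.mul (Real.hasDerivAt_log hx.ne')).const_mul α).add (hpow.const_mul β))]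
    have e : x ^ ((k : ℝ) - i) * x⁻¹ = x ^ ((k : ℝ) - i - 1) := by
      rw [Real.rpow_sub_one hx.ne', div_eq_mul_inv]
    rw [e]
    push_cast
    rw [← sub_sub]
    ring

theorem contDiffOn_powerFun (m₁ m₂ : ℕ) (q : ℝ) (N : ℕ) :
    ContDiffOn ℝ N (powerFun m₁ m₂ q) (Ioi 0) := by
  intro x hx
  have hx' : x ≠ 0 := ne_of_gt hx
  refine ContDiffAt.contDiffWithinAt ?_
  by_cases h : ∃ k : ℕ, k ≤ m₁ + m₂ + 1 ∧ q = k
  · rw [show powerFun m₁ m₂ q = fun x => x ^ q * Real.log x by ext; simp only [powerFun, if_pos h]]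
    exact (Real.contDiffAt_rpow_const_of_ne hx').mul (Real.contDiffAt_log.2 hx')
  · rw [show powerFun m₁ m₂ q = fun x => x ^ q by ext; simp only [powerFun, if_neg h]]
    exact Real.contDiffAt_rpow_const_of_ne hx'

theorem exists_iteratedDeriv_powerFun (m₁ m₂ : ℕ) (q : ℝ) : ∃ C : ℝ, C ≠ 0 ∧ ∀ x, 0 < x →
    iteratedDeriv (m₁ + m₂ + 2) (powerFun m₁ m₂ q) x = C * x ^ (q - (m₁ + m₂ + 2 : ℕ)) := by
  by_cases h : ∃ k : ℕ, k ≤ m₁ + m₂ + 1 ∧ q = k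
  · rw [show powerFun m₁ m₂ q = fun x => x ^ q * Real.log x by ext; simp only [powerFun, if_pos h]]
    obtain ⟨k, hk, rfl⟩ := h
    obtain ⟨α, β, hα, hd⟩ := iteratedDeriv_rpow_mul_log k k le_rfl
    simp only [sub_self, Real.rpow_zero, one_mul, mul_one] at hd
    have h1 : ∀ x : ℝ, 0 < x → iteratedDeriv (k + 1) (fun x : ℝ => x ^ (k : ℝ) * Real.log x) x =
        α * x ^ (-1 : ℝ) := fun x hx => by
      rw [iteratedDeriv_succ, deriv_eq_of_eqOn_Ioi (fun y hy => hd y hy) hx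
        (((Real.hasDerivAt_log hx.ne').const_mul α).add_const β), Real.rpow_neg_one]
    -- Starting from exponent `-1`, no further differentiation kills the power.
    obtain ⟨C, hC, h2⟩ := iteratedDeriv_add_eq_rpow hα h1 (m₁ + m₂ + 1 - k) fun l _ => by
      have : (0 : ℝ) ≤ l := l.cast_nonneg
      linarith
    refine ⟨C, hC, fun x hx => ?_⟩
    rw [show m₁ + m₂ + 2 = k + 1 + (m₁ + m₂ + 1 - k) by omega, h2 x hx]
    congr 2
    push_cast
    ring
  · rw [show powerFun m₁ m₂ q = fun x => x ^ q by ext; simp only [powerFun, if_neg h]]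
    obtain ⟨C, hC, h2⟩ := iteratedDeriv_add_eq_rpow (g := fun x : ℝ => x ^ q) (i := 0) (p := q)
      one_ne_zero (by simp) (m₁ + m₂ + 2) fun l hl hq => h ⟨l, by omega, hq⟩
    exact ⟨C, hC, fun x hx => by rw [← h2 x hx, zero_add]⟩

theorem crossesLike_powerFun {m₁ m₂ : ℕ} (hm : m₂ < m₁) (q : ℝ) :
    CrossesLike (powerFun m₁ m₂ q) m₁ m₂ fun x => x ^ (q - (m₁ + m₂ + 2 : ℕ)) := by
  obtain ⟨C, hC, h⟩ := exists_iteratedDeriv_powerFun m₁ m₂ q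
  exact crossesLike_of_iteratedDeriv hm (contDiffOn_powerFun m₁ m₂ q _) hC h

end PowerFun

/-! ### Asymptotics of a homogeneous mean on short intervals. -/

theorem hermiteMean_spec_of_isMean {f : ℝ → ℝ} {m₁ m₂ : ℕ} (h : IsMean (hermiteMean f m₁ m₂))
    {a b : ℝ} (ha : 0 < a) (hab : a < b) :
    hermiteMean f m₁ m₂ a b ∈ Ioo a b ∧
      IsHermiteCrossing f m₁ m₂ a b (hermiteMean f m₁ m₂ a b) ∧
      ∀ y ∈ Ioo a b, IsHermiteCrossing f m₁ m₂ a b y → y = hermiteMean f m₁ m₂ a b := by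
  have hbound := (h.2 a b ha (ha.trans hab)).1
  rw [min_eq_left hab.le] at hbound
  by_cases hex : ∃! x, x ∈ Ioo (min a b) (max a b) ∧
      IsHermiteCrossing f m₁ m₂ (min a b) (max a b) x
  · rw [min_eq_left hab.le, max_eq_right hab.le] at hex
    obtain ⟨x, ⟨hx, hc⟩, hu⟩ := hex
    have hu' : ∀ y ∈ Ioo a b, IsHermiteCrossing f m₁ m₂ a b y → y = x :=
      fun y hy hyc => hu y ⟨hy, hyc⟩
    rw [hermiteMean_eq hx hc hu']
    exact ⟨hx, hc, hu'⟩
  -- The default value `0` lies below `a`, contrary to the mean inequality.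
  · rw [hermiteMean, if_neg hab.ne, dif_neg hex] at hbound
    linarith

/-- Squeezes `φ` between two affine functions; the constant `η` contributes only `η / N! ≤ η`, with
`N = L.length`. -/
theorem abs_remIter_sub_affine_le {L : List ℝ} {a b : ℝ} (ha : 0 < a) (hL : ∀ c ∈ L, c ∈ Icc a b)
    {φ : ℝ → ℝ} (hφ : ContinuousOn φ (Ioi 0)) {α β η : ℝ}
    (h : ∀ y ∈ Icc a b, |φ y - (α * y + β)| ≤ η) {x : ℝ} (hx : x ∈ Icc a b) :
    |remIter 0 L φ x - (α * (x + L.sum) / ((L.length + 1).factorial : ℝ) +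
      β / (L.length.factorial : ℝ))| ≤ η := by
  have hη : 0 ≤ η := (abs_nonneg _).trans (h x hx)
  have h1 := remIter_mono 0 ha hL hφ (ψ := fun y => α * y + (β + η)) (by fun_prop)
    (fun y hy => by linarith [(abs_le.1 (h y hy)).2]) hx
  have h2 := remIter_mono 0 ha hL (φ := fun y => α * y + (β - η)) (by fun_prop) hφ
    (fun y hy => by linarith [(abs_le.1 (h y hy)).1]) hx
  rw [remIter_affine] at h1 h2
  have h3 : η / (L.length.factorial : ℝ) ≤ η :=
    div_le_self hη (by exact_mod_cast Nat.succ_le_of_lt (Nat.factorial_pos _))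
  simp only [add_div, sub_div] at h1 h2
  rw [abs_le]
  constructor <;> linarith

theorem eventually_abs_sub_affine_le {φ : ℝ → ℝ} {φ' a : ℝ} (ha : 0 < a) (h : HasDerivAt φ φ' a)
    {ε : ℝ} (hε : 0 < ε) : ∀ᶠ t in 𝓝[>] (0 : ℝ), ∀ y ∈ Icc a (a + a * t),
      |φ y - (φ' * y + (φ a - φ' * a))| ≤ ε * t := by
  have h1 := h.isLittleO.def (div_pos hε ha)
  obtain ⟨δ, hδ, hball⟩ := Metric.eventually_nhds_iff.1 h1
  filter_upwards [Ioo_mem_nhdsGT (div_pos hδ ha)] with t ht y hy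
  have hat : a * t < δ := by
    have := (lt_div_iff₀ ha).1 ht.2
    linarith
  have hya : |y - a| ≤ a * t := by
    rw [abs_of_nonneg (by linarith [hy.1])]; linarith [hy.2]
  have h2 := hball (y := y) (by rw [Real.dist_eq]; linarith)
  simp only [Real.norm_eq_abs, smul_eq_mul] at h2
  calc |φ y - (φ' * y + (φ a - φ' * a))| = |φ y - φ a - (y - a) * φ'| := by congr 1; ring
    _ ≤ ε / a * |y - a| := h2
    _ ≤ ε / a * (a * t) := by gcongr
    _ = ε * t := by field_simp

theorem eventually_abs_hermRem_sub_le {φ : ℝ → ℝ} {φ' a : ℝ} (ha : 0 < a)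
    (hφ : ContinuousOn φ (Ioi 0)) (h : HasDerivAt φ φ' a) (r s : ℕ) {ε : ℝ} (hε : 0 < ε) :
    ∀ᶠ t in 𝓝[>] (0 : ℝ), ∀ u ∈ Icc (0 : ℝ) 1,
      |hermRem r s φ a (a + a * t) (a + a * t * u) -
        (φ a / ((r + s + 2).factorial : ℝ) +
          φ' * a / ((r + s + 3).factorial : ℝ) * t * (u + (s + 1)))| ≤ ε * t ∧
      |hermRem r s φ (a + a * t) a (a + a * t * u) -
        (φ a / ((r + s + 2).factorial : ℝ) +
          φ' * a / ((r + s + 3).factorial : ℝ) * t * (u + (r + 1)))| ≤ ε * t := by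
  filter_upwards [eventually_abs_sub_affine_le ha h hε, self_mem_nhdsWithin] with t hy ht u hu
  have hat : 0 < a * t := mul_pos ha ht
  have hx : a + a * t * u ∈ Icc a (a + a * t) := by
    constructor <;> nlinarith [hu.1, hu.2]
  have hsucc : ((r + s + 3).factorial : ℝ) = (r + s + 3) * ((r + s + 2).factorial : ℝ) := by
    rw [Nat.factorial_succ]; push_cast; ring
  have hN : ((r + s + 2).factorial : ℝ) ≠ 0 := by positivity
  have hN' : (r : ℝ) + s + 3 ≠ 0 := by positivity
  constructor
  · have := abs_remIter_sub_affine_le (L := hermNodes r s a (a + a * t) ++ [a]) ha ?_ hφ hy hx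
    · rw [length_hermNodes_append] at this
      convert this using 2
      rw [hermRem, hsucc]
      congr 1
      simp [hermNodes]
      field_simp
      ring
    · intro c hc
      rcases mem_hermNodes_append hc with rfl | rfl
      · exact ⟨le_rfl, by linarith⟩
      · exact ⟨by linarith, le_rfl⟩
  · have := abs_remIter_sub_affine_le (L := hermNodes r s (a + a * t) a ++ [a + a * t]) ha ?_ hφ
      hy hx
    · rw [length_hermNodes_append] at this
      convert this using 2
      rw [hermRem, hsucc]
      congr 1
      simp [hermNodes]
      field_simp
      ring
    · intro c hc
      rcases mem_hermNodes_append hc with rfl | rfl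
      · exact ⟨by linarith, le_rfl⟩
      · exact ⟨le_rfl, by linarith⟩

/-- The first order coefficient in the expansion of the crossing equation on short intervals. -/
def crossCoeff (m₁ m₂ : ℕ) (u : ℝ) : ℝ :=
  (1 - u) ^ (m₁ - m₂) * (u + (m₁ + 1)) - u ^ (m₁ - m₂) * (u + (m₂ + 1))

theorem abs_crossing_expansion_le {k : ℕ} {u A K t D₁ D₂ ε r s : ℝ} (hu : u ∈ Icc (0 : ℝ) 1)
    (hA : A ≠ 0) (hD : u ^ k * D₁ = (1 - u) ^ k * D₂)
    (h₁ : |D₁ - (A + K * t * (u + s))| ≤ ε) (h₂ : |D₂ - (A + K * t * (u + r))| ≤ ε) :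
    |u ^ k - (1 - u) ^ k - t * (K / A) * ((1 - u) ^ k * (u + r) - u ^ k * (u + s))| ≤
      2 * ε / |A| := by
  have e : u ^ k - (1 - u) ^ k - t * (K / A) * ((1 - u) ^ k * (u + r) - u ^ k * (u + s)) =
      ((1 - u) ^ k * (D₂ - (A + K * t * (u + r))) - u ^ k * (D₁ - (A + K * t * (u + s)))) / A := by
    field_simp
    linear_combination hD
  have p1 : u ^ k ≤ 1 := pow_le_one₀ hu.1 hu.2
  have p2 : (1 - u) ^ k ≤ 1 := pow_le_one₀ (by linarith [hu.2]) (by linarith [hu.1])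
  have p3 : 0 ≤ u ^ k := pow_nonneg hu.1 k
  have p4 : 0 ≤ (1 - u) ^ k := pow_nonneg (by linarith [hu.2]) k
  rw [e, abs_div]
  gcongr
  refine (abs_sub _ _).trans ?_
  rw [abs_mul, abs_mul, abs_of_nonneg p3, abs_of_nonneg p4]
  nlinarith [abs_nonneg (D₂ - (A + K * t * (u + r))), abs_nonneg (D₁ - (A + K * t * (u + s)))]

theorem abs_crossCoeff_le (m₁ m₂ : ℕ) {u : ℝ} (hu : u ∈ Icc (0 : ℝ) 1) :
    |crossCoeff m₁ m₂ u| ≤ m₁ + m₂ + 4 := by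
  have p1 : u ^ (m₁ - m₂) ≤ 1 := pow_le_one₀ hu.1 hu.2
  have p2 : (1 - u) ^ (m₁ - m₂) ≤ 1 := pow_le_one₀ (by linarith [hu.2]) (by linarith [hu.1])
  have p3 : 0 ≤ u ^ (m₁ - m₂) := pow_nonneg hu.1 _
  have p4 : 0 ≤ (1 - u) ^ (m₁ - m₂) := pow_nonneg (by linarith [hu.2]) _
  have q1 : (0 : ℝ) ≤ m₁ := m₁.cast_nonneg
  have q2 : (0 : ℝ) ≤ m₂ := m₂.cast_nonneg
  have r1 : 0 ≤ u + ((m₁ : ℝ) + 1) := by linarith [hu.1]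
  have r2 : 0 ≤ u + ((m₂ : ℝ) + 1) := by linarith [hu.1]
  have s1 := mul_le_mul_of_nonneg_right p2 r1
  have s2 := mul_le_mul_of_nonneg_right p1 r2
  have s3 := mul_nonneg p4 r1
  have s4 := mul_nonneg p3 r2
  unfold crossCoeff
  rw [abs_le]
  constructor <;> linarith [hu.2]

/-- With `w = uᵏ - (1 - u)ᵏ` and `v = (1 - u)ᵏ`, the coefficient is `v (m₁ - m₂) - w (u + m₂ + 1)`.
Here `2 v + w ≥ (1/2)ᵏ`, so a small `w` keeps it positive. -/
theorem le_crossCoeff {m₁ m₂ : ℕ} (hm : m₂ < m₁) {u : ℝ} (hu : u ∈ Icc (0 : ℝ) 1)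
    (hw : |u ^ (m₁ - m₂) - (1 - u) ^ (m₁ - m₂)| ≤ (1 / 2) ^ (m₁ - m₂) / (4 * (m₂ + 3))) :
    (1 / 2) ^ (m₁ - m₂) / 4 ≤ crossCoeff m₁ m₂ u := by
  obtain ⟨k, hk⟩ : ∃ k, m₁ - m₂ = k := ⟨_, rfl⟩
  have hm1 : (m₂ : ℝ) + 1 ≤ m₁ := by exact_mod_cast hm
  unfold crossCoeff
  rw [hk] at hw ⊢
  have p3 : 0 ≤ u ^ k := pow_nonneg hu.1 _
  have p4 : 0 ≤ (1 - u) ^ k := pow_nonneg (by linarith [hu.2]) _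
  have hsum : (1 / 2 : ℝ) ^ k ≤ u ^ k + (1 - u) ^ k := by
    rcases le_total (1 / 2) u with h | h
    · have : (1 / 2 : ℝ) ^ k ≤ u ^ k := by gcongr
      linarith
    · have : (1 / 2 : ℝ) ^ k ≤ (1 - u) ^ k := by gcongr; linarith
      linarith
  have q2 : (0 : ℝ) ≤ m₂ := m₂.cast_nonneg
  rw [le_div_iff₀ (by positivity)] at hw
  set w := u ^ k - (1 - u) ^ k with hwdef
  set v := (1 - u) ^ k
  have hu' : u ^ k = w + v := by rw [hwdef]; ring
  rw [hu'] at hsum ⊢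
  have h1 : v * (m₁ - m₂) ≥ v := by nlinarith
  have h2 : w * (u + (m₂ + 1)) ≤ |w| * (m₂ + 2) :=
    (mul_le_mul_of_nonneg_right (le_abs_self w) (by linarith [hu.1])).trans
      (mul_le_mul_of_nonneg_left (by linarith [hu.2]) (abs_nonneg w))
  have h3 := le_abs_self w
  have h4 := abs_nonneg w
  nlinarith

/-- The position of `M(1, 1 + t)` in `[1, 1 + t]`, rescaled to `[0, 1]`. -/
noncomputable def relPos (m : ℝ → ℝ → ℝ) (t : ℝ) : ℝ := (m 1 (1 + t) - 1) / t

section Asymptotics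

variable {f : ℝ → ℝ} {m₁ m₂ : ℕ}

theorem relPos_mem (hM : IsHomogeneousMean (hermiteMean f m₁ m₂)) {t : ℝ} (ht : 0 < t) :
    relPos (hermiteMean f m₁ m₂) t ∈ Icc (0 : ℝ) 1 := by
  have := (hermiteMean_spec_of_isMean hM.1 one_pos (by linarith : (1 : ℝ) < 1 + t)).1
  unfold relPos
  constructor
  · exact div_nonneg (by linarith [this.1]) ht.le
  · rw [div_le_one ht]; linarith [this.2]

/-- Homogeneity enters here: the position measured on `[1, 1 + t]` solves the crossing equation on
`[a, a + a t]` for every `a`. -/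
theorem pow_relPos_mul_hermRem (hm : m₂ < m₁)
    (hf : ContDiffOn ℝ (m₁ + m₂ + 2 : ℕ) f (Ioi 0))
    (hM : IsHomogeneousMean (hermiteMean f m₁ m₂)) {a t : ℝ} (ha : 0 < a) (ht : 0 < t) :
    relPos (hermiteMean f m₁ m₂) t ^ (m₁ - m₂) *
        hermRem m₁ m₂ (iteratedDeriv (m₁ + m₂ + 2) f) a (a + a * t)
          (a + a * t * relPos (hermiteMean f m₁ m₂) t) =
      (1 - relPos (hermiteMean f m₁ m₂) t) ^ (m₁ - m₂) *
        hermRem m₁ m₂ (iteratedDeriv (m₁ + m₂ + 2) f) (a + a * t) a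
          (a + a * t * relPos (hermiteMean f m₁ m₂) t) := by
  have hat : 0 < a * t := mul_pos ha ht
  obtain ⟨hx, hc, -⟩ := hermiteMean_spec_of_isMean hM.1 ha (by linarith : a < a + a * t)
  have hxe : hermiteMean f m₁ m₂ a (a + a * t) =
      a + a * t * relPos (hermiteMean f m₁ m₂) t := by
    have := hM.2 a 1 (1 + t) ha one_pos (by linarith)
    rw [mul_one, mul_add, mul_one] at this
    rw [this, relPos]
    field_simp
    ring
  rw [isHermiteCrossing_iff hm hf ha hx, hxe] at hc
  unfold crossFun at hc
  rw [show ∀ u : ℝ, a + a * t * u - a = a * t * u from fun u => by ring,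
    show ∀ u : ℝ, a + a * t - (a + a * t * u) = a * t * (1 - u) from fun u => by ring,
    mul_pow (a * t), mul_pow (a * t), mul_assoc ((a * t) ^ (m₁ - m₂)),
    mul_assoc ((a * t) ^ (m₁ - m₂)), ← mul_sub, mul_eq_zero,
    or_iff_right (pow_ne_zero _ hat.ne'), sub_eq_zero] at hc
  exact hc

theorem eventually_relPos_expansion (hm : m₂ < m₁)
    (hf : ContDiffOn ℝ (m₁ + m₂ + 2 : ℕ) f (Ioi 0))
    (hM : IsHomogeneousMean (hermiteMean f m₁ m₂)) {a φ' : ℝ} (ha : 0 < a)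
    (hφ : HasDerivAt (iteratedDeriv (m₁ + m₂ + 2) f) φ' a)
    (hne : iteratedDeriv (m₁ + m₂ + 2) f a ≠ 0) {ε : ℝ} (hε : 0 < ε) :
    ∀ᶠ t in 𝓝[>] (0 : ℝ),
      |relPos (hermiteMean f m₁ m₂) t ^ (m₁ - m₂) - (1 - relPos (hermiteMean f m₁ m₂) t) ^ (m₁ - m₂)
        - t * (a * φ' / iteratedDeriv (m₁ + m₂ + 2) f a / (m₁ + m₂ + 3)) *
          crossCoeff m₁ m₂ (relPos (hermiteMean f m₁ m₂) t)| ≤ ε * t := by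
  have hN : ((m₁ + m₂ + 2).factorial : ℝ) ≠ 0 := by positivity
  have hA : iteratedDeriv (m₁ + m₂ + 2) f a / ((m₁ + m₂ + 2).factorial : ℝ) ≠ 0 :=
    div_ne_zero hne hN
  have hA' := abs_pos.2 hA
  filter_upwards [eventually_abs_hermRem_sub_le ha (hf.isDerivChain.continuousOn le_rfl) hφ m₁ m₂
    (mul_pos (half_pos hε) hA'), self_mem_nhdsWithin] with t h ht
  have hu := relPos_mem hM ht
  obtain ⟨h1, h2⟩ := h _ hu
  have := abs_crossing_expansion_le hu hA (pow_relPos_mul_hermRem hm hf hM ha ht) h1 h2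
  have hN' : (m₁ : ℝ) + m₂ + 3 ≠ 0 := by positivity
  convert this using 1
  · unfold crossCoeff
    congr 3
    rw [Nat.factorial_succ (m₁ + m₂ + 2)]
    push_cast
    rw [show (m₁ : ℝ) + m₂ + 2 + 1 = m₁ + m₂ + 3 by ring]
    field_simp
  · field_simp

/-- The expansions at `a` and `b` involve the same `u`; subtracting them leaves `t (ca - cb) ·
crossCoeff u = o(t)`. -/
theorem logDeriv_iteratedDeriv_const (hm : m₂ < m₁)
    (hf : ContDiffOn ℝ (m₁ + m₂ + 2 : ℕ) f (Ioi 0))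
    (hM : IsHomogeneousMean (hermiteMean f m₁ m₂)) {a b φa φb : ℝ} (ha : 0 < a) (hb : 0 < b)
    (hφa : HasDerivAt (iteratedDeriv (m₁ + m₂ + 2) f) φa a)
    (hφb : HasDerivAt (iteratedDeriv (m₁ + m₂ + 2) f) φb b)
    (hna : iteratedDeriv (m₁ + m₂ + 2) f a ≠ 0) (hnb : iteratedDeriv (m₁ + m₂ + 2) f b ≠ 0) :
    a * φa / iteratedDeriv (m₁ + m₂ + 2) f a = b * φb / iteratedDeriv (m₁ + m₂ + 2) f b := by
  have hN' : (m₁ : ℝ) + m₂ + 3 ≠ 0 := by positivity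
  rw [← div_left_inj' hN']
  set ca := a * φa / iteratedDeriv (m₁ + m₂ + 2) f a / (m₁ + m₂ + 3)
  set cb := b * φb / iteratedDeriv (m₁ + m₂ + 2) f b / (m₁ + m₂ + 3)
  by_contra hne
  have hd : 0 < |ca - cb| := abs_pos.2 (sub_ne_zero.2 hne)
  set θ : ℝ := (1 / 2) ^ (m₁ - m₂) with hθ
  have hθ0 : 0 < θ := by positivity
  -- Chosen so that the final bound `|ca - cb| θ / 4 ≤ 2 ε` is contradictory.
  set ε := |ca - cb| * θ / 16 with hεdef
  have hε : 0 < ε := by positivity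
  -- `|w| ≤ K t`, so the upper limit on `t` is what brings `w` into the range of `le_crossCoeff`.
  set K := |ca| * (m₁ + m₂ + 4) + ε with hK
  have hK0 : 0 < K := by positivity
  obtain ⟨t, ⟨h1, h2⟩, ht⟩ := (((eventually_relPos_expansion hm hf hM ha hφa hna hε).and
    (eventually_relPos_expansion hm hf hM hb hφb hnb hε)).and
    (Ioo_mem_nhdsGT (show (0 : ℝ) < θ / (4 * (m₂ + 3)) / K by positivity))).exists
  have hu := relPos_mem hM ht.1
  set u := relPos (hermiteMean f m₁ m₂) t
  set B := crossCoeff m₁ m₂ u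
  set w := u ^ (m₁ - m₂) - (1 - u) ^ (m₁ - m₂)
  change |w - t * ca * B| ≤ ε * t at h1
  change |w - t * cb * B| ≤ ε * t at h2
  have hB : |B| ≤ m₁ + m₂ + 4 := abs_crossCoeff_le m₁ m₂ hu
  have hw : |w| ≤ θ / (4 * (m₂ + 3)) := by
    have e1 : |t * ca * B| ≤ t * (|ca| * (m₁ + m₂ + 4)) := by
      rw [abs_mul, abs_mul, abs_of_pos ht.1, mul_assoc]
      have := ht.1.le
      gcongr
    have e2 : |w| ≤ |w - t * ca * B| + |t * ca * B| := by
      simpa using abs_add_le (w - t * ca * B) (t * ca * B)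
    have e3 := (lt_div_iff₀ hK0).1 ht.2
    rw [hK] at e3
    linarith
  have hB' : θ / 4 ≤ B := le_crossCoeff hm hu hw
  have h3 : |t * (ca - cb) * B| ≤ 2 * (ε * t) := by
    have e : t * (ca - cb) * B = (w - t * cb * B) - (w - t * ca * B) := by ring
    rw [e]
    exact (abs_sub _ _).trans (by linarith)
  rw [abs_mul, abs_mul, abs_of_pos ht.1, abs_of_pos (by linarith : 0 < B), mul_assoc] at h3
  have h4 : |ca - cb| * B ≤ 2 * ε := le_of_mul_le_mul_left (by linarith) ht.1
  have h5 : |ca - cb| * (θ / 4) ≤ |ca - cb| * B := by gcongr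
  have h6 : 0 < |ca - cb| * θ := by positivity
  rw [hεdef] at h4
  linarith

end Asymptotics

/-! ### Euler's equation and the conclusion. -/

theorem eq_const_mul_rpow_of_euler {φ φ' : ℝ → ℝ} {p a : ℝ}
    (hφ : ∀ x, 0 < x → HasDerivAt φ (φ' x) x) (ha : 0 < a) (hne : φ a ≠ 0)
    (h : ∀ x, 0 < x → φ x ≠ 0 → x * φ' x = p * φ x) :
    ∃ c : ℝ, c ≠ 0 ∧ ∀ x, 0 < x → φ x = c * x ^ p := by
  have hψ : ∀ x, 0 < x → HasDerivAt (fun x => φ x * x ^ (-p))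
      ((x * φ' x - p * φ x) * x ^ (-p - 1)) x := fun x hx => by
    refine ((hφ x hx).mul (Real.hasDerivAt_rpow_const (Or.inl hx.ne'))).congr_deriv ?_
    have : x ^ (-p) = x ^ (-p - 1) * x := by
      rw [← Real.rpow_add_one hx.ne']; congr 1; ring
    rw [this]
    ring
  -- The equation is known only where `φ ≠ 0`. The square of `φ x ^ (-p)` has zero derivative at
  -- zeros of `φ` too, so it is constant and `φ` never vanishes.
  have hsq : ∀ x, 0 < x → HasDerivAt (fun x => (φ x * x ^ (-p)) ^ 2) 0 x := fun x hx => by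
    refine ((hψ x hx).pow 2).congr_deriv ?_
    by_cases h0 : φ x = 0
    · simp [h0]
    · simp [h x hx h0]
  have hsqc : ∀ x, 0 < x → (φ x * x ^ (-p)) ^ 2 = (φ a * a ^ (-p)) ^ 2 := fun x hx =>
    isOpen_Ioi.is_const_of_deriv_eq_zero (convex_Ioi 0).isPreconnected
      (fun y hy => (hsq y hy).differentiableAt.differentiableWithinAt)
      (fun y hy => (hsq y hy).deriv) hx ha
  have hc : φ a * a ^ (-p) ≠ 0 := mul_ne_zero hne (Real.rpow_pos_of_pos ha _).ne'
  have hnz : ∀ x, 0 < x → φ x ≠ 0 := fun x hx h0 => by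
    have := hsqc x hx
    rw [h0, zero_mul, zero_pow two_ne_zero] at this
    exact pow_ne_zero 2 hc this.symm
  refine ⟨φ a * a ^ (-p), hc, fun x hx => ?_⟩
  have hψ0 : ∀ x, 0 < x → HasDerivAt (fun x => φ x * x ^ (-p)) 0 x := fun x hx =>
    (hψ x hx).congr_deriv (by rw [h x hx (hnz x hx), sub_self, zero_mul])
  have := isOpen_Ioi.is_const_of_deriv_eq_zero (convex_Ioi 0).isPreconnected
      (fun y hy => (hψ0 y hy).differentiableAt.differentiableWithinAt)
      (fun y hy => (hψ0 y hy).deriv) (show x ∈ Ioi (0 : ℝ) from hx) (show a ∈ Ioi (0 : ℝ) from ha)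
  rw [← this, mul_assoc, ← Real.rpow_add hx, neg_add_cancel, Real.rpow_zero, mul_one]

/-- If `φ` vanished identically, every point between the endpoints would be a crossing, against
uniqueness. -/
theorem exists_iteratedDeriv_ne_zero {f : ℝ → ℝ} {m₁ m₂ : ℕ} (hm : m₂ < m₁)
    (hf : ContDiffOn ℝ (m₁ + m₂ + 2 : ℕ) f (Ioi 0)) (hM : IsMean (hermiteMean f m₁ m₂)) :
    ∃ a, 0 < a ∧ iteratedDeriv (m₁ + m₂ + 2) f a ≠ 0 := by
  by_contra! h
  obtain ⟨-, -, hu⟩ := hermiteMean_spec_of_isMean hM one_pos one_lt_two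
  have hc : ∀ x ∈ Ioo (1 : ℝ) 2, IsHermiteCrossing f m₁ m₂ 1 2 x := fun x hx => by
    rw [isHermiteCrossing_iff hm hf one_pos hx, crossFun_congr (ψ := fun _ => 0 * 0)
      (fun y hy => by simpa using h y hy) one_pos two_pos (one_pos.trans hx.1),
      crossFun_const_mul (φ := fun _ => 0), zero_mul]
  have h1 : (4 / 3 : ℝ) ∈ Ioo (1 : ℝ) 2 := by norm_num
  have h2 : (5 / 3 : ℝ) ∈ Ioo (1 : ℝ) 2 := by norm_num
  have := (hu _ h1 (hc _ h1)).trans (hu _ h2 (hc _ h2)).symm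
  norm_num at this

theorem theorem9 (m₁ m₂ n : ℕ) (hm : m₂ < m₁) (hn : n = m₁ + m₂ + 1) :
    (∀ f : ℝ → ℝ, ContDiffOn ℝ (n + 2 : ℕ) f (Set.Ioi 0) →
      IsHomogeneousMean (hermiteMean f m₁ m₂) →
        ∃ c p : ℝ, (∀ x : ℝ, 0 < x → iteratedDeriv (n + 1) f x = c * x ^ p) ∧
          ∀ a b : ℝ, 0 < a → 0 < b →
            hermiteMean f m₁ m₂ a b = powerHermiteMean (p + n + 1) m₁ m₂ a b) ∧
    (∀ q : ℝ, IsHomogeneousMean (powerHermiteMean q m₁ m₂)) := by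
  refine ⟨fun f hf hM => ?_, fun q => (crossesLike_powerFun hm q).isHomogeneousMean_of_rpow hm⟩
  subst hn
  have hf' : ContDiffOn ℝ (m₁ + m₂ + 2 : ℕ) f (Ioi 0) :=
    hf.of_le (by exact_mod_cast (by omega : m₁ + m₂ + 2 ≤ m₁ + m₂ + 1 + 2))
  have hφ : ∀ x, 0 < x → HasDerivAt (iteratedDeriv (m₁ + m₂ + 2) f)
      (iteratedDeriv (m₁ + m₂ + 3) f x) x :=
    hf.isDerivChain.hasDerivAt (m₁ + m₂ + 2) (by omega)
  obtain ⟨a, ha, hna⟩ := exists_iteratedDeriv_ne_zero hm hf' hM.1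
  set p := a * iteratedDeriv (m₁ + m₂ + 3) f a / iteratedDeriv (m₁ + m₂ + 2) f a with hp
  obtain ⟨c, hc, hcp⟩ := eq_const_mul_rpow_of_euler (p := p) hφ ha hna fun x hx hnx => by
    rw [hp, logDeriv_iteratedDeriv_const hm hf' hM ha hx (hφ a ha) (hφ x hx) hna hnx,
      div_mul_cancel₀ _ hnx]
  refine ⟨c, p, hcp, fun x y hx hy => ?_⟩
  have hg := crossesLike_powerFun hm (p + (m₁ + m₂ + 1 : ℕ) + 1)
  rw [show p + (m₁ + m₂ + 1 : ℕ) + 1 - (m₁ + m₂ + 2 : ℕ) = p by push_cast; ring] at hg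
  exact (crossesLike_of_iteratedDeriv hm hf' hc hcp).hermiteMean_eq_hermiteMean hg hm
    (fun z hz => (Real.continuousAt_rpow_const z p (Or.inl (ne_of_gt hz))).continuousWithinAt)
    (fun z hz => Real.rpow_pos_of_pos hz p) hx hy
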